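/- A matroid $k$-parity constraint on a finite ground set $E$ consists of a matroid $\mathcal M$ on a vertex set $V$ and a partition of $V$ into blocks $v(e)$, $e\in E$, of at most $k$ vertices each; a set $S\subseteq E$ is feasible if $\bigcup_{e\in S} v(e)$ is independent in $\mathcal M$. An algorithm receives $|E|$ and $\varepsilon$, accesses the constraint through a feasibility oracle ($S\mapsto$ whether $S$ is feasible) and the objective $f\colon 2^E\to\mathbb R$ through a value oracle ($S\mapsto f(S)$), and may draw independent uniform random reals from $[0,1]$. Running time is counted on a real RAM: arithmetic operations and comparisons of reals (no rounding), additions, subtractions and comparisons of natural numbers (used also as addresses), random draws and oracle calls each take one step. The algorithm has approximation ratio $\rho$ if its output $A$ is always feasible and $\max\{f(O): O \text{ feasible}\}\le \rho\cdot\mathbb E[f(A)]$. There are an algorithm, a polynomial $P$ and a constant $C$ such that for every $\varepsilon>0$, every $k\ge 1$, every finite $E$ and every matroid $k$-parity constraint on $E$ the following holds, the algorithm not being given $k$. 1. If $f\colon 2^E\to\mathbb R_{\ge 0}$ is monotone and submodular, then, for every outcome of its random draws, the algorithm halts within $P(|E|,1/\varepsilon)$ steps, and it has approximation ratio $$\frac{2k\ln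 2}{1+\ln 2}+C\sqrt k\;\le\;0.819\,k+C\sqrt k .$$ 2. If $f$ is linear, i.e. $f(S)=\sum_{e\in S}w_e$ for some real weights $w_e$, then, for every outcome of its random draws, the algorithm halts within $P(|E|,1/\varepsilon)$ steps, and it has approximation ratio $$(k+1)\ln 2+C\varepsilon\;\le\;0.694\,k+0.694+C\varepsilon .$$ -/

import Mathlib

/-! ### Constraints and objective functions -/

/-- A matroid `k`-parity constraint with set of edges `E` and set of vertices `V`: a matroid on `V`
together with a partition of `V` into blocks of at most `k` vertices, one block `edge e` for each
`e : E`.  (A block may be empty, in which case the edge can always be added.) -/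
structure MatroidParity (k : ℕ) (E : Type*) (V : Type*) where
  /-- the matroid on the vertices -/
  matroid : Matroid V
  ground_eq : matroid.E = Set.univ
  /-- the vertices of an edge -/
  edge : E → Finset V
  card_edge_le : ∀ e, (edge e).card ≤ k
  disjoint_edge : ∀ e e', e ≠ e' → Disjoint (edge e) (edge e')
  cover : ∀ x : V, ∃ e, x ∈ edge e

/-- A set of edges is feasible if the union of its edges is independent in the matroid. -/
def MatroidParity.Feasible {k : ℕ} {E V : Type*} (I : MatroidParity k E V) (S : Finset E) : Prop :=
  I.matroid.Indep (⋃ e ∈ S, (I.edge e : Set V))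

/-- Submodularity (diminishing returns): `f(e ∣ S) ≥ f(e ∣ T)` for `S ⊆ T` and `e ∉ T`. -/
def IsSubmodular {E : Type*} [DecidableEq E] (f : Finset E → ℝ) : Prop :=
  ∀ S T : Finset E, S ⊆ T → ∀ e, e ∉ T → f (insert e T) - f T ≤ f (insert e S) - f S

/-- A linear set function: `f(S) = ∑_{e ∈ S} w_e` for some real weights `w_e`. -/
def IsLinearSetFunction {E : Type*} (f : Finset E → ℝ) : Prop :=
  ∃ w : E → ℝ, ∀ S, f S = ∑ e ∈ S, w e

/-! ### The machine model: a randomized real RAM with oracles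

The memory consists of arrays of natural numbers and arrays of real numbers.  Arrays are named by
numerals that are fixed in the program text; the indices into them are computed, and the scalars of
a program are the cells of index `0`.  Naturals can only be added, subtracted and compared; reals
support the four field operations and comparisons, all at unit cost.  There is no rounding from
reals to naturals, and a program text contains no real constants. -/

namespace RealRAM

/-- Memory of the machine, with the number of random reals drawn so far. -/
structure State where
  /-- `nat x i` is the content of cell `i` of the array `x` of naturals -/
  nat : ℕ → ℕ → ℕ
  /-- `real x i` is the content of cell `i` of the array `x` of reals -/
  real : ℕ → ℕ → ℝ
  /-- number of random reals drawn so far -/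
  draws : ℕ

/-- Replace the cell `i` of the array `x` of naturals by `v`. -/
def State.setNat (s : State) (x i v : ℕ) : State :=
  { s with nat := Function.update s.nat x (Function.update (s.nat x) i v) }

/-- Replace the cell `i` of the array `x` of reals by `v`. -/
def State.setReal (s : State) (x i : ℕ) (v : ℝ) : State :=
  { s with real := Function.update s.real x (Function.update (s.real x) i v) }

/-- Expressions with values in the naturals; `get x i` reads the cell `i` of the array `x`. -/
inductive NatExpr where
  | const (m : ℕ)
  | get (x : ℕ) (i : NatExpr)
  | add (a b : NatExpr)
  | sub (a b : NatExpr)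

/-- Value of an expression (subtraction is truncated). -/
def NatExpr.eval (s : State) : NatExpr → ℕ
  | const m => m
  | get x i => s.nat x (i.eval s)
  | add a b => a.eval s + b.eval s
  | sub a b => a.eval s - b.eval s

/-- Number of operations needed to evaluate an expression. -/
def NatExpr.cost : NatExpr → ℕ
  | const _ => 1
  | get _ i => i.cost + 1
  | add a b => a.cost + b.cost + 1
  | sub a b => a.cost + b.cost + 1

/-- Expressions with values in the reals. -/
inductive RealExpr where
  | ofNat (a : NatExpr)
  | get (x : ℕ) (i : NatExpr)
  | add (a b : RealExpr)
  | sub (a b : RealExpr)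
  | mul (a b : RealExpr)
  | div (a b : RealExpr)

/-- Value of an expression (a quotient by zero is zero). -/
noncomputable def RealExpr.eval (s : State) : RealExpr → ℝ
  | ofNat a => (a.eval s : ℝ)
  | get x i => s.real x (i.eval s)
  | add a b => a.eval s + b.eval s
  | sub a b => a.eval s - b.eval s
  | mul a b => a.eval s * b.eval s
  | div a b => a.eval s / b.eval s

/-- Number of operations needed to evaluate an expression. -/
def RealExpr.cost : RealExpr → ℕ
  | ofNat a => a.cost + 1
  | get _ i => i.cost + 1
  | add a b => a.cost + b.cost + 1
  | sub a b => a.cost + b.cost + 1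
  | mul a b => a.cost + b.cost + 1
  | div a b => a.cost + b.cost + 1

/-- Tests. -/
inductive Test where
  | natLe (a b : NatExpr)
  | realLe (a b : RealExpr)
  | neg (p : Test)
  | conj (p q : Test)

/-- Truth of a test. -/
def Test.Holds (s : State) : Test → Prop
  | natLe a b => a.eval s ≤ b.eval s
  | realLe a b => a.eval s ≤ b.eval s
  | neg p => ¬ p.Holds s
  | conj p q => p.Holds s ∧ q.Holds s

/-- Number of operations needed to evaluate a test. -/
def Test.cost : Test → ℕ
  | natLe a b => a.cost + b.cost + 1
  | realLe a b => a.cost + b.cost + 1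
  | neg p => p.cost + 1
  | conj p q => p.cost + q.cost + 1

/-- Programs. -/
inductive Program where
  | skip
  /-- `x[i] := a` for an array `x` of naturals -/
  | assignNat (x : ℕ) (i a : NatExpr)
  /-- `x[i] := a` for an array `x` of reals -/
  | assignReal (x : ℕ) (i : NatExpr) (a : RealExpr)
  /-- `x[0] :=` a fresh random real, for an array `x` of reals -/
  | draw (x : ℕ)
  /-- ask the feasibility oracle about the set stored in the array `y`;
  `x[0]` becomes `1` or `0`, for an array `x` of naturals -/
  | askFeasible (x y : ℕ)
  /-- ask the value oracle about the set stored in the array `y`;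
  `x[0]` becomes its value, for an array `x` of reals -/
  | askValue (x y : ℕ)
  | seq (p q : Program)
  | ite (b : Test) (p q : Program)
  | while (b : Test) (p : Program)

/-- The subset of `{0, …, n - 1}` whose characteristic vector is stored in the array `x`. -/
def State.storedSet (n : ℕ) (s : State) (x : ℕ) : Finset (Fin n) :=
  Finset.univ.filter fun e => s.nat x e ≠ 0

open Classical in
/-- `Exec I f ω p s s' t`: started in the state `s`, the program `p` halts in the state `s'` after
exactly `t` steps, where `I` is the feasibility oracle, `f` the value oracle, and `ω` the sequence
of the random reals that are drawn one after the other. -/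
inductive Exec {n : ℕ} (I : Finset (Fin n) → Prop) (f : Finset (Fin n) → ℝ)
    (ω : ℕ → unitInterval) : Program → State → State → ℕ → Prop
  | skip (s : State) : Exec I f ω .skip s s 1
  | assignNat (s : State) (x : ℕ) (i a : NatExpr) :
      Exec I f ω (.assignNat x i a) s (s.setNat x (i.eval s) (a.eval s)) (i.cost + a.cost + 1)
  | assignReal (s : State) (x : ℕ) (i : NatExpr) (a : RealExpr) :
      Exec I f ω (.assignReal x i a) s (s.setReal x (i.eval s) (a.eval s)) (i.cost + a.cost + 1)
  | draw (s : State) (x : ℕ) :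
      Exec I f ω (.draw x) s { s.setReal x 0 (ω s.draws : ℝ) with draws := s.draws + 1 } 1
  | askFeasible (s : State) (x y : ℕ) :
      Exec I f ω (.askFeasible x y) s (s.setNat x 0 (if I (s.storedSet n y) then 1 else 0)) 1
  | askValue (s : State) (x y : ℕ) :
      Exec I f ω (.askValue x y) s (s.setReal x 0 (f (s.storedSet n y))) 1
  | seq (p q : Program) (s s' s'' : State) (t t' : ℕ) :
      Exec I f ω p s s' t → Exec I f ω q s' s'' t' → Exec I f ω (.seq p q) s s'' (t + t')
  | iteTrue (b : Test) (p q : Program) (s s' : State) (t : ℕ) :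
      b.Holds s → Exec I f ω p s s' t → Exec I f ω (.ite b p q) s s' (b.cost + t)
  | iteFalse (b : Test) (p q : Program) (s s' : State) (t : ℕ) :
      ¬ b.Holds s → Exec I f ω q s s' t → Exec I f ω (.ite b p q) s s' (b.cost + t)
  | whileTrue (b : Test) (p : Program) (s s' s'' : State) (t t' : ℕ) :
      b.Holds s → Exec I f ω p s s' t → Exec I f ω (.while b p) s' s'' t' →
        Exec I f ω (.while b p) s s'' (b.cost + t + t')
  | whileFalse (b : Test) (p : Program) (s : State) :
      ¬ b.Holds s → Exec I f ω (.while b p) s s b.cost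

/-- Initial memory: the size `n` of the ground set is the cell `0` of the array `0` of naturals,
the parameter `ε` is the cell `0` of the array `0` of reals, and all other cells are zero. -/
noncomputable def init (n : ℕ) (ε : ℝ) : State where
  nat x i := if x = 0 ∧ i = 0 then n else 0
  real x i := if x = 0 ∧ i = 0 then ε else 0
  draws := 0

/-- On the input `(n, ε)`, with oracles `I` and `f` and random reals `ω`, the program halts after
exactly `t` steps with output `A`; the output is the set stored in the array `1` of naturals. -/
def Program.Outputs (p : Program) {n : ℕ} (I : Finset (Fin n) → Prop) (f : Finset (Fin n) → ℝ)
    (ε : ℝ) (ω : ℕ → unitInterval) (A : Finset (Fin n)) (t : ℕ) : Prop :=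
  ∃ s', Exec I f ω p (init n ε) s' t ∧ s'.storedSet n 1 = A

/-- The law of the random reals: independent and uniform in the unit interval. -/
noncomputable def coinLaw : MeasureTheory.Measure (ℕ → unitInterval) :=
  MeasureTheory.Measure.infinitePi fun _ => MeasureTheory.volume

/-- For all outcomes of its random draws, the program halts on the input `(n, ε)` with oracles `I`
and `f` within `P(n, 1/ε)` steps and outputs a feasible set `A`; and
`max {f(O) : O feasible} ≤ ratio * 𝔼[f(A)]`. -/
def Program.Approximates (p : Program) (P : MvPolynomial (Fin 2) ℕ) {n : ℕ}
    (I : Finset (Fin n) → Prop) (f : Finset (Fin n) → ℝ) (ε ratio : ℝ) : Prop :=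
  ∃ A : (ℕ → unitInterval) → Finset (Fin n),
    (∀ ω, ∃ t : ℕ, p.Outputs I f ε ω (A ω) t ∧
      (t : ℝ) ≤ MvPolynomial.aeval ![(n : ℝ), ε⁻¹] P) ∧
    (∀ ω, I (A ω)) ∧
    MeasureTheory.Integrable (fun ω => f (A ω)) coinLaw ∧
    ∀ O, I O → f O ≤ ratio * ∫ ω, f (A ω) ∂coinLaw

end RealRAM

/-! The algorithm is a local search with geometrically decreasing thresholds `w, w / b, w / b ^ 2,
…`, where `b` is at least `2` and close to it. At threshold `τ` an element may be added, or one
element added at this same level may be exchanged for two, provided that each new element has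
marginal value at least `τ` when it enters and the result is feasible. Every accepted move enlarges
the set of elements of the current level by one, so at most `n` moves happen per level. By
submodularity the final solution is worth at least the sum of the thresholds of its elements.

The combinatorial core is `MatroidParity.sum_weight_le_of_locally_optimal`: if the weights of a
competitor `O` are rounded down to the thresholds, they sum to at most `(k + 1) / 2` times the
thresholds of the solution. Contract the levels of the solution one after the other, keeping a set
`Q i` of vertices of `O` that stays independent over level `i`. An element added at level `i`
destroys at most `k` vertices of `O`, on average over its level, and each destroyed vertex is paid
`θ i / 2`. An edge of `O` with rounded weight `θ j` that loses a vertex before level `j` is fully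
paid, because thresholds at least halve. An edge intact until then must lose a vertex at level `j`,
otherwise it could have been added; two lost vertices pay for it. If it loses exactly one, half of
its weight is missing; `Matroid.card_le_of_exchange` shows that there are no more such edges than
elements of the level, since otherwise a one-for-two exchange would be possible. This gives `k / 2 +
1 / 2`.

Rounding a value down to a progression of ratio `2` with a logarithmically uniform offset keeps a
fraction `1 / (2 ln 2)` in expectation. Hence the factor `(k + 1) / 2` becomes `(k + 1) ln 2`. The
offset is not drawn: `Parameters.mul_le_sum_roundDown` averages over `M ≈ N ln 2` discrete offsets,
all of which are tried, and the best set is at least as good as the average. The scale of the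
thresholds is also found by trial, from the marginal value of every single element.

For linear functions, elements common to `O` and the solution are compared directly. For monotone
submodular functions, an element of `O` either keeps a fraction `1 - δ` of its marginal value after
the solution has been chosen, and then the core lemma applies, or it loses at least `δ` of it; the
total loss is at most the value of the solution, which costs an additional `1 / δ`. With `δ` of
order `1 / √k` the ratio is `k ln 2 + O(√k)`, which is stronger than required since `1 + ln 2 ≤ 2`.
-/

namespace RealRAM

/-! ### A program logic with running times -/

/-- `iterate g N x` applies `g 0`, `g 1`, …, `g (N - 1)` to `x` in this order. -/
def iterate {α : Type*} (g : ℕ → α → α) : ℕ → α → α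
  | 0, x => x
  | N + 1, x => g N (iterate g N x)

/-- The arrays of naturals that a program may write to. -/
def Program.natWrites : Program → Finset ℕ
  | .skip => ∅
  | .assignNat x _ _ => {x}
  | .assignReal _ _ _ => ∅
  | .draw _ => ∅
  | .askFeasible x _ => {x}
  | .askValue _ _ => ∅
  | .seq p q => p.natWrites ∪ q.natWrites
  | .ite _ p q => p.natWrites ∪ q.natWrites
  | .while _ p => p.natWrites

/-- The frame property: it lets a loop counter survive the body of its loop. -/
theorem Exec.nat_eq {n : ℕ} {I : Finset (Fin n) → Prop} {f : Finset (Fin n) → ℝ}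
    {ω : ℕ → unitInterval} {p : Program} {s s' : State} {t : ℕ} (h : Exec I f ω p s s' t)
    {x : ℕ} (hx : x ∉ p.natWrites) : s'.nat x = s.nat x := by
  induction h <;> simp_all [Program.natWrites, State.setNat, State.setReal]

/-- Programs without loops and random draws. -/
def Program.Straight : Program → Prop
  | .seq p q => p.Straight ∧ q.Straight
  | .ite _ p q => p.Straight ∧ q.Straight
  | .while _ _ => False
  | .draw _ => False
  | _ => True

/-- An upper bound for the running time of a program without loops. -/
def Program.maxCost : Program → ℕ
  | .assignNat _ i a => i.cost + a.cost + 1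
  | .assignReal _ i a => i.cost + a.cost + 1
  | .seq p q => p.maxCost + q.maxCost
  | .ite b p q => b.cost + (p.maxCost + q.maxCost)
  | _ => 1

open Classical in
/-- The final state of a program without loops. -/
noncomputable def Program.final {n : ℕ} (I : Finset (Fin n) → Prop) (f : Finset (Fin n) → ℝ) :
    Program → State → State
  | .assignNat x i a, s => s.setNat x (i.eval s) (a.eval s)
  | .assignReal x i a, s => s.setReal x (i.eval s) (a.eval s)
  | .askFeasible x y, s => s.setNat x 0 (if I (s.storedSet n y) then 1 else 0)
  | .askValue x y, s => s.setReal x 0 (f (s.storedSet n y))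
  | .seq p q, s => q.final I f (p.final I f s)
  | .ite b p q, s => if b.Holds s then p.final I f s else q.final I f s
  | _, s => s

/-- Without loops and draws, execution is a function of the memory, so the correctness of a basic
block reduces to simplifying `Program.final`. -/
theorem Program.Straight.exec {n : ℕ} (I : Finset (Fin n) → Prop) (f : Finset (Fin n) → ℝ)
    (ω : ℕ → unitInterval) {p : Program} (hp : p.Straight) (s : State) :
    ∃ t, Exec I f ω p s (p.final I f s) t ∧ t ≤ p.maxCost := by
  induction p generalizing s with
  | skip => exact ⟨_, .skip s, le_rfl⟩
  | assignNat x i a => exact ⟨_, .assignNat s x i a, le_rfl⟩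
  | assignReal x i a => exact ⟨_, .assignReal s x i a, le_rfl⟩
  | draw x => exact hp.elim
  | askFeasible x y => exact ⟨_, .askFeasible s x y, le_rfl⟩
  | askValue x y => exact ⟨_, .askValue s x y, le_rfl⟩
  | seq p q ihp ihq =>
    obtain ⟨t, h, ht⟩ := ihp hp.1 s
    obtain ⟨t', h', ht'⟩ := ihq hp.2 (p.final I f s)
    exact ⟨_, .seq p q _ _ _ _ _ h h', by simp only [maxCost]; omega⟩
  | ite b p q ihp ihq =>
    by_cases hb : b.Holds s
    · obtain ⟨t, h, ht⟩ := ihp hp.1 s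
      refine ⟨_, .iteTrue b p q s _ t hb ?_, by simp only [maxCost]; omega⟩
      simpa [final, hb] using h
    · obtain ⟨t, h, ht⟩ := ihq hp.2 s
      refine ⟨_, .iteFalse b p q s _ t hb ?_, by simp only [maxCost]; omega⟩
      simpa [final, hb] using h
  | _ => exact hp.elim

/-- Within `T` steps, the program `p` transforms any state satisfying `R` into one satisfying `R'`. -/
def Maps {n : ℕ} (I : Finset (Fin n) → Prop) (f : Finset (Fin n) → ℝ) (ω : ℕ → unitInterval)
    (p : Program) (T : ℕ) (R R' : State → Prop) : Prop :=
  ∀ s, R s → ∃ s' t, Exec I f ω p s s' t ∧ t ≤ T ∧ R' s'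

section Rules

variable {n : ℕ} {I : Finset (Fin n) → Prop} {f : Finset (Fin n) → ℝ} {ω : ℕ → unitInterval}

theorem Maps.seq {p q : Program} {T T' : ℕ} {R R' R'' : State → Prop}
    (hp : Maps I f ω p T R R') (hq : Maps I f ω q T' R' R'') :
    Maps I f ω (.seq p q) (T + T') R R'' := by
  intro s hs
  obtain ⟨s', t, h, ht, hs'⟩ := hp s hs
  obtain ⟨s'', t', h', ht', hs''⟩ := hq s' hs'
  exact ⟨s'', _, .seq p q _ _ _ _ _ h h', by omega, hs''⟩

theorem Maps.mono {p : Program} {T T' : ℕ} {R R₁ R' R₁' : State → Prop}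
    (hp : Maps I f ω p T R R') (hT : T ≤ T') (h : ∀ s, R₁ s → R s) (h' : ∀ s, R' s → R₁' s) :
    Maps I f ω p T' R₁ R₁' := by
  intro s hs
  obtain ⟨s', t, he, ht, hs'⟩ := hp s (h s hs)
  exact ⟨s', t, he, ht.trans hT, h' s' hs'⟩

theorem Maps.of_straight {p : Program} {R R' : State → Prop} (hp : p.Straight)
    (h : ∀ s, R s → R' (p.final I f s)) : Maps I f ω p p.maxCost R R' := by
  intro s hs
  obtain ⟨t, he, ht⟩ := hp.exec I f ω s
  exact ⟨_, t, he, ht, h s hs⟩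

theorem Maps.ite {b : Test} {p q : Program} {T T' : ℕ} {R R' : State → Prop}
    (hp : Maps I f ω p T (fun s => R s ∧ b.Holds s) R')
    (hq : Maps I f ω q T' (fun s => R s ∧ ¬ b.Holds s) R') :
    Maps I f ω (.ite b p q) (b.cost + (T + T')) R R' := by
  intro s hs
  by_cases hb : b.Holds s
  · obtain ⟨s', t, he, ht, hs'⟩ := hp s ⟨hs, hb⟩
    exact ⟨s', _, .iteTrue b p q s s' t hb he, by omega, hs'⟩
  · obtain ⟨s', t, he, ht, hs'⟩ := hq s ⟨hs, hb⟩
    exact ⟨s', _, .iteFalse b p q s s' t hb he, by omega, hs'⟩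

/-- A loop whose test fails once the counter of its rounds has reached `N`. -/
theorem Maps.while {b : Test} {p : Program} {T N : ℕ} {R : ℕ → State → Prop} {R' : State → Prop}
    (hp : ∀ i, Maps I f ω p T (fun s => R i s ∧ b.Holds s) (R (i + 1)))
    (hN : ∀ i s, R i s → b.Holds s → i < N)
    (hR' : ∀ i s, R i s → ¬ b.Holds s → R' s) :
    Maps I f ω (.while b p) (N * (T + b.cost) + b.cost) (R 0) R' := by
  -- `m` is the remaining budget of rounds after round `i`.
  have key : ∀ m i, N ≤ m + i →
      Maps I f ω (.while b p) (m * (T + b.cost) + b.cost) (R i) R' := by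
    intro m
    induction m with
    | zero =>
      intro i hi s hs
      have hb : ¬ b.Holds s := fun hb => by have := hN i s hs hb; omega
      exact ⟨s, _, .whileFalse b p s hb, by omega, hR' i s hs hb⟩
    | succ m ih =>
      intro i hi s hs
      by_cases hb : b.Holds s
      · obtain ⟨s', t, he, ht, hs'⟩ := hp i s ⟨hs, hb⟩
        obtain ⟨s'', t', he', ht', hs''⟩ := ih (i + 1) (by omega) s' hs'
        refine ⟨s'', _, .whileTrue b p _ _ _ _ _ hb he he', ?_, hs''⟩
        rw [Nat.succ_mul]
        omega
      · exact ⟨s, _, .whileFalse b p s hb, by omega, hR' i s hs hb⟩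
  exact key N 0 (by omega)

end Rules

/-- `for x[0] = 0, …, bound - 1 do p` -/
def Program.for (x : ℕ) (bound : NatExpr) (p : Program) : Program :=
  .seq (.assignNat x (.const 0) (.const 0))
    (.while (.natLe (.add (.get x (.const 0)) (.const 1)) bound)
      (.seq p (.assignNat x (.const 0) (.add (.get x (.const 0)) (.const 1)))))

/-- The program loop simulates the functional loop `iterate g N`. The relation `R` has to ignore the
counter, which the loop itself changes; and since the bound is evaluated anew in each round, it must
have the value `N` in every state allowed by `R`. -/
theorem Maps.for {n : ℕ} {I : Finset (Fin n) → Prop} {f : Finset (Fin n) → ℝ}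
    {ω : ℕ → unitInterval} {α : Type*} {R : α → State → Prop} (g : ℕ → α → α) {x : ℕ}
    {bound : NatExpr} {p : Program} {T N : ℕ} (hx : x ∉ p.natWrites)
    (hbound : ∀ a s, R a s → bound.eval s = N)
    (hR : ∀ a s v, R a s → R a (s.setNat x 0 v))
    (hp : ∀ i a, i < N → Maps I f ω p T (fun s => R a s ∧ s.nat x 0 = i) (R (g i a))) (a : α) :
    Maps I f ω (.for x bound p) ((N + 1) * (T + bound.cost + 20)) (R a) (R (iterate g N a)) := by
  have hinit : Maps I f ω (.assignNat x (.const 0) (.const 0)) 3 (R a)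
      (fun s => R (iterate g 0 a) s ∧ s.nat x 0 = 0 ∧ 0 ≤ N) := by
    refine Maps.of_straight trivial fun s hs => ?_
    simp only [Program.final, NatExpr.eval]
    exact ⟨hR _ _ _ hs, by simp [State.setNat], Nat.zero_le _⟩
  have hloop := Maps.while (I := I) (f := f) (ω := ω) (N := N) (T := T + 6)
    (b := .natLe (.add (.get x (.const 0)) (.const 1)) bound)
    (p := .seq p (.assignNat x (.const 0) (.add (.get x (.const 0)) (.const 1))))
    (R := fun i s => R (iterate g i a) s ∧ s.nat x 0 = i ∧ i ≤ N) (R' := R (iterate g N a))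
    ?_ ?_ ?_
  · refine (hinit.seq hloop).mono ?_ (fun s hs => hs) (fun s hs => hs)
    simp only [Test.cost, NatExpr.cost]
    ring_nf
    omega
  · intro i s hs
    obtain ⟨⟨h1, h2, h3⟩, hb⟩ := hs
    simp only [Test.Holds, NatExpr.eval, h2, hbound _ _ h1] at hb
    obtain ⟨s', t, he, ht, hs'⟩ := hp i _ hb s ⟨h1, h2⟩
    have hi : s'.nat x 0 = i := by rw [he.nat_eq hx, h2]
    refine ⟨_, _, .seq _ _ _ _ _ _ _ he (.assignNat _ _ _ _), ?_, ?_⟩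
    · simp only [NatExpr.cost]
      omega
    · simp only [NatExpr.eval, hi]
      exact ⟨hR _ _ _ hs', by simp [State.setNat], hb⟩
  · intro i s ⟨h1, h2, _⟩ hb
    simp only [Test.Holds, NatExpr.eval, h2, hbound _ _ h1] at hb
    omega
  · intro i s ⟨h1, h2, h3⟩ hb
    simp only [Test.Holds, NatExpr.eval, h2, hbound _ _ h1] at hb
    obtain rfl : i = N := by omega
    exact h1

end RealRAM

namespace RealRAM

/-! ### Sets indexed by naturals -/

/-- Add the element number `i`, if there is one. -/
def put {n : ℕ} (A : Finset (Fin n)) (i : ℕ) : Finset (Fin n) :=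
  A ∪ Finset.univ.filter fun e => (e : ℕ) = i

/-- Remove the element number `i`, if there is one. -/
def del {n : ℕ} (A : Finset (Fin n)) (i : ℕ) : Finset (Fin n) :=
  A.filter fun e => (e : ℕ) ≠ i

/-- The element number `i` exists and lies in `A`. -/
def Has {n : ℕ} (A : Finset (Fin n)) (i : ℕ) : Prop := ∃ e ∈ A, (e : ℕ) = i

@[simp] theorem mem_put {n : ℕ} {A : Finset (Fin n)} {i : ℕ} {e : Fin n} :
    e ∈ put A i ↔ e ∈ A ∨ (e : ℕ) = i := by
  simp [put]

@[simp] theorem mem_del {n : ℕ} {A : Finset (Fin n)} {i : ℕ} {e : Fin n} :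
    e ∈ del A i ↔ e ∈ A ∧ (e : ℕ) ≠ i := by
  simp [del]

theorem has_iff {n : ℕ} {A : Finset (Fin n)} {i : ℕ} (hi : i < n) : Has A i ↔ ⟨i, hi⟩ ∈ A := by
  constructor
  · rintro ⟨e, he, rfl⟩
    exact he
  · exact fun h => ⟨_, h, rfl⟩

theorem has_val {n : ℕ} {A : Finset (Fin n)} {e : Fin n} : Has A e ↔ e ∈ A :=
  has_iff e.2

/-! ### Reading memory -/

@[simp] theorem State.setNat_nat (s : State) (x i v y : ℕ) :
    (s.setNat x i v).nat y = if y = x then Function.update (s.nat x) i v else s.nat y := by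
  by_cases h : y = x <;> simp [State.setNat, Function.update, h]

@[simp] theorem State.setNat_real (s : State) (x i v : ℕ) : (s.setNat x i v).real = s.real := rfl

@[simp] theorem State.setReal_nat (s : State) (x i : ℕ) (v : ℝ) :
    (s.setReal x i v).nat = s.nat := rfl

@[simp] theorem State.setReal_real (s : State) (x i : ℕ) (v : ℝ) (y : ℕ) :
    (s.setReal x i v).real y = if y = x then Function.update (s.real x) i v else s.real y := by
  by_cases h : y = x <;> simp [State.setReal, Function.update, h]

@[simp] theorem State.storedSet_setReal (n : ℕ) (s : State) (x i : ℕ) (v : ℝ) (y : ℕ) :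
    (s.setReal x i v).storedSet n y = s.storedSet n y := rfl

@[simp] theorem State.storedSet_setNat (n : ℕ) (s : State) (x i v y : ℕ) :
    (s.setNat x i v).storedSet n y =
      if y = x then if v = 0 then del (s.storedSet n x) i else put (s.storedSet n x) i
      else s.storedSet n y := by
  by_cases h : y = x
  · subst h
    by_cases hv : v = 0
    · ext e
      by_cases he : (e : ℕ) = i <;> simp [State.storedSet, Function.update, hv, he]
    · ext e
      by_cases he : (e : ℕ) = i <;> simp [State.storedSet, Function.update, hv, he]
  · ext e
    simp [State.storedSet, h]

theorem has_storedSet {n i : ℕ} (hi : i < n) (s : State) (x : ℕ) :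
    Has (s.storedSet n x) i ↔ s.nat x i ≠ 0 := by
  simp [has_iff hi, State.storedSet]

/-! ### The algorithm as a function -/

section Functions

variable {n : ℕ} (I : Finset (Fin n) → Prop) (f : Finset (Fin n) → ℝ)

/-- The condition under which `a` is exchanged for `o` and `o'`; here `a = n` means that no element
is removed, in which case `o = o'`. -/
def Acceptable (τ : ℝ) (a o o' : ℕ) (X : Finset (Fin n) × Finset (Fin n)) : Prop :=
  (((n ≤ a ∧ o = o') ∨ (¬ n ≤ a ∧ o ≠ o' ∧ Has X.1 a ∧ Has X.2 a)) ∧ ¬ Has X.1 o ∧ ¬ Has X.1 o') ∧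
    I (put (put (del X.1 a) o) o') ∧ τ ≤ f (put (del X.1 a) o) - f (del X.1 a) ∧
    (o = o' ∨ τ ≤ f (put (put (del X.1 a) o) o') - f (put (del X.1 a) o))

open Classical in
/-- Exchange `a` for `o` and `o'` if possible.  The first set is the current solution, the second
one consists of the elements that may be removed. -/
noncomputable def attempt (τ : ℝ) (a o o' : ℕ) (X : Finset (Fin n) × Finset (Fin n)) :
    Finset (Fin n) × Finset (Fin n) :=
  if Acceptable I f τ a o o' X then
    (put (put (del X.1 a) o) o', put (put (del X.2 a) o) o')
  else X

/-- Try all exchanges. -/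
noncomputable def scan (τ : ℝ) :
    Finset (Fin n) × Finset (Fin n) → Finset (Fin n) × Finset (Fin n) :=
  iterate (fun a => iterate (fun o => iterate (fun o' => attempt I f τ a o o') n) n) (n + 1)

/-- Local search with threshold `τ`. -/
noncomputable def search (τ : ℝ) (A : Finset (Fin n)) : Finset (Fin n) × Finset (Fin n) :=
  iterate (fun _ => scan I f τ) (n + 1) (A, ∅)

/-- Local search with the thresholds `w, w / b, w / b ^ 2, …, w / b ^ (N - 1)`. -/
noncomputable def descend (b w : ℝ) (N : ℕ) : ℝ × Finset (Fin n) :=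
  iterate (fun _ (X : ℝ × Finset (Fin n)) => (X.1 / b, (search I f X.1 X.2).1)) N (w, ∅)

open Classical in
/-- Replace `B` by the result of `descend`, if that is better; and divide `w` by `y`. -/
noncomputable def improve (N : ℕ) (y b : ℝ) (X : ℝ × Finset (Fin n)) : ℝ × Finset (Fin n) :=
  (X.1 / y, if f X.2 ≤ f (descend I f b X.1 N).2 then (descend I f b X.1 N).2 else X.2)

/-- The best set found from the initial thresholds `w, w / y, w / y ^ 2, …, w / y ^ (M - 1)`,
where `w` is the marginal value of a single element. -/
noncomputable def bestSet (N M : ℕ) (y b : ℝ) : Finset (Fin n) :=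
  iterate (fun e B => (iterate (fun _ => improve I f N y b) M (f (put ∅ e) - f ∅, B)).2) n ∅

end Functions

/-! ### The program -/

/-- The cell `0` of an array of naturals. -/
abbrev cell (x : ℕ) : NatExpr := .get x (.const 0)

/-- The cell `0` of an array of reals. -/
abbrev realCell (x : ℕ) : RealExpr := .get x (.const 0)

/-- Assignment to the cell `0` of an array of reals. -/
abbrev setRealCell (x : ℕ) (a : RealExpr) : Program := .assignReal x (.const 0) a

/-- Disjunction of tests. -/
def Test.disj (p q : Test) : Test := .neg (.conj (.neg p) (.neg q))

/-- Equality of naturals. -/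
def Test.natEq (a b : NatExpr) : Test := .conj (.natLe a b) (.natLe b a)

@[simp] theorem Test.disj_holds (p q : Test) (s : State) :
    (Test.disj p q).Holds s ↔ p.Holds s ∨ q.Holds s := by
  simp only [Test.disj, Test.Holds]
  tauto

@[simp] theorem Test.natEq_holds (a b : NatExpr) (s : State) :
    (Test.natEq a b).Holds s ↔ a.eval s = b.eval s := by
  simp only [Test.natEq, Test.Holds]
  omega

/-- The array `x` of naturals contains a nonzero number at the index `i`. -/
def Test.nonzero (x : ℕ) (i : NatExpr) : Test := .neg (.natLe (.get x i) (.const 0))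

@[simp] theorem Test.nonzero_holds (x : ℕ) (i : NatExpr) (s : State) :
    (Test.nonzero x i).Holds s ↔ s.nat x (i.eval s) ≠ 0 := by
  simp [Test.nonzero, Test.Holds, NatExpr.eval]

/-- Test whether the arguments of an exchange are admissible. -/
def guardTest : Test :=
  .conj (.disj (.conj (.natLe (cell 0) (cell 10)) (.natEq (cell 11) (cell 12)))
      (.conj (.neg (.natLe (cell 0) (cell 10))) (.conj (.neg (.natEq (cell 11) (cell 12)))
        (.conj (.nonzero 2 (cell 10)) (.nonzero 3 (cell 10))))))
    (.conj (.neg (.nonzero 2 (cell 11))) (.neg (.nonzero 2 (cell 12))))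

/-- Exchange elements, and ask for the values and the feasibility. -/
def probeProgram : Program :=
  .seq (.assignNat 2 (cell 10) (.const 0)) (.seq (.askValue 5 2)
    (.seq (.assignNat 2 (cell 11) (.const 1)) (.seq (.askValue 6 2)
      (.seq (.assignNat 2 (cell 12) (.const 1)) (.seq (.askValue 7 2) (.askFeasible 4 2))))))

/-- Test whether the exchange is an improvement. -/
def acceptTest : Test :=
  .conj (.nonzero 4 (.const 0)) (.conj (.realLe (realCell 4) (.sub (realCell 6) (realCell 5)))
    (.disj (.natEq (cell 11) (cell 12)) (.realLe (realCell 4) (.sub (realCell 7) (realCell 6)))))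

def commitProgram : Program :=
  .seq (.assignNat 3 (cell 10) (.const 0)) (.seq (.assignNat 3 (cell 11) (.const 1))
    (.assignNat 3 (cell 12) (.const 1)))

def undoProgram : Program :=
  .seq (.assignNat 2 (cell 11) (.const 0)) (.seq (.assignNat 2 (cell 12) (.const 0))
    (.assignNat 2 (cell 10) (.const 1)))

def attemptProgram : Program :=
  .ite guardTest (.seq probeProgram (.ite acceptTest commitProgram undoProgram)) .skip

def clearProgram (x : ℕ) : Program := .for 13 (cell 0) (.assignNat x (cell 13) (.const 0))

def copyProgram : Program := .for 13 (cell 0) (.assignNat 1 (cell 13) (.get 2 (cell 13)))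

def scanProgram : Program :=
  .for 10 (.add (cell 0) (.const 1)) (.for 11 (cell 0) (.for 12 (cell 0) attemptProgram))

def searchProgram : Program :=
  .seq (clearProgram 3) (.for 14 (.add (cell 0) (.const 1)) scanProgram)

def descendProgram : Program :=
  .seq (.seq (clearProgram 2) (setRealCell 4 (realCell 3)))
    (.for 15 (.add (cell 5) (.const 1))
      (.seq searchProgram (setRealCell 4 (.div (realCell 4) (realCell 2)))))

def improveProgram : Program :=
  .seq descendProgram (.seq (.seq (.askValue 5 1) (.askValue 6 2))
    (.seq (.ite (.realLe (realCell 5) (realCell 6)) copyProgram .skip)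
      (setRealCell 3 (.div (realCell 3) (realCell 1)))))

def bestSetProgram : Program :=
  .for 17 (cell 0) (.seq
    (.seq (clearProgram 2) (.seq (.askValue 5 2) (.seq (.assignNat 2 (cell 17) (.const 1))
      (.seq (.askValue 6 2) (setRealCell 3 (.sub (realCell 6) (realCell 5)))))))
    (.for 16 (cell 6) improveProgram))

def parameterProgram : Program :=
  .seq (.seq (.assignNat 5 (.const 0) (.add (cell 0) (.const 1)))
      (.while (.neg (.realLe (.ofNat (cell 0)) (.mul (.ofNat (cell 5)) (realCell 0))))
        (.assignNat 5 (.const 0) (.add (cell 5) (.const 1)))))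
    (.seq (.seq (setRealCell 1 (.add (.ofNat (.const 1)) (.div (.ofNat (.const 1)) (.ofNat (cell 5)))))
        (setRealCell 2 (.ofNat (.const 1))))
      (.while (.neg (.realLe (.ofNat (.const 2)) (realCell 2)))
        (.seq (setRealCell 2 (.mul (realCell 2) (realCell 1)))
          (.assignNat 6 (.const 0) (.add (cell 6) (.const 1))))))

/-- The algorithm: it is deterministic, since instead of drawing the initial threshold it tries all
candidates and returns the best solution. -/
def parityProgram : Program := .seq parameterProgram bestSetProgram

/-! ### Correctness of the program -/

/-- The contents of the memory during the computation. -/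
structure Rep {n : ℕ} (N M : ℕ) (y b w τ : ℝ) (B A L : Finset (Fin n)) (s : State) : Prop where
  size : s.nat 0 0 = n
  best : s.storedSet n 1 = B
  current : s.storedSet n 2 = A
  removable : s.storedSet n 3 = L
  levels : s.nat 5 0 = N
  trials : s.nat 6 0 = M
  ratio : s.real 1 0 = y
  base : s.real 2 0 = b
  start : s.real 3 0 = w
  threshold : s.real 4 0 = τ

theorem Rep.setNat {n : ℕ} {N M : ℕ} {y b w τ : ℝ} {B A L : Finset (Fin n)} {s : State}
    (h : Rep N M y b w τ B A L s) (x i v : ℕ) (hx : 7 ≤ x) :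
    Rep N M y b w τ B A L (s.setNat x i v) := by
  have h0 : 0 ≠ x := by omega
  have h1 : 1 ≠ x := by omega
  have h2 : 2 ≠ x := by omega
  have h3 : 3 ≠ x := by omega
  have h5 : 5 ≠ x := by omega
  have h6 : 6 ≠ x := by omega
  constructor <;>
    simp [h0, h1, h2, h3, h5, h6, h.size, h.best, h.current, h.removable, h.levels, h.trials,
      h.ratio, h.base, h.start, h.threshold]

section Correctness

variable {n : ℕ} {I : Finset (Fin n) → Prop} {f : Finset (Fin n) → ℝ} {ω : ℕ → unitInterval}

/-- Exchanges are tried in place in array `2`; this is why `undoProgram` restores it after a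
rejection. For `a = n` the writes hit a cell that `storedSet` does not read. -/
theorem put_del_del {A : Finset (Fin n)} {a o o' : ℕ} (ha : n ≤ a ∨ Has A a) (ho : ¬ Has A o)
    (ho' : ¬ Has A o') : put (del (del (put (put (del A a) o) o') o) o') a = A := by
  ext e
  simp only [mem_put, mem_del]
  constructor
  · rintro (h | rfl)
    · tauto
    · rcases ha with h | h
      · exact absurd e.2 (by omega)
      · exact has_val.1 h
  · intro h
    have h1 : (e : ℕ) ≠ o := fun h' => ho ⟨e, h, h'⟩
    have h2 : (e : ℕ) ≠ o' := fun h' => ho' ⟨e, h, h'⟩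
    tauto

theorem guardTest_holds {s : State} {a o o' : ℕ} (hn : s.nat 0 0 = n) (ha : s.nat 10 0 = a)
    (ho : s.nat 11 0 = o) (ho' : s.nat 12 0 = o') (hon : o < n) (hon' : o' < n) :
    guardTest.Holds s ↔ ((n ≤ a ∧ o = o') ∨ (¬ n ≤ a ∧ o ≠ o' ∧ Has (s.storedSet n 2) a ∧
      Has (s.storedSet n 3) a)) ∧ ¬ Has (s.storedSet n 2) o ∧ ¬ Has (s.storedSet n 2) o' := by
  have h (x : ℕ) (hx : ¬ n ≤ a) := has_storedSet (not_le.1 hx) s x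
  rw [has_storedSet hon, has_storedSet hon']
  simp only [guardTest, Test.Holds, Test.disj_holds, Test.natEq_holds, Test.nonzero_holds,
    NatExpr.eval, hn, ha, ho, ho']
  by_cases hx : n ≤ a
  · simp [hx]
  · rw [h 2 hx, h 3 hx]

/-- The memory together with the arguments of an exchange. -/
def RepArgs (N M : ℕ) (y b w τ : ℝ) (B : Finset (Fin n)) (a o o' : ℕ)
    (X : Finset (Fin n) × Finset (Fin n)) (s : State) : Prop :=
  ((Rep N M y b w τ B X.1 X.2 s ∧ s.nat 10 0 = a) ∧ s.nat 11 0 = o) ∧ s.nat 12 0 = o'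

open Classical in
theorem maps_probe {N M : ℕ} {y b w τ : ℝ} {B A L : Finset (Fin n)} {a o o' : ℕ} :
    Maps I f ω probeProgram probeProgram.maxCost (RepArgs N M y b w τ B a o o' (A, L))
      (fun s => RepArgs N M y b w τ B a o o' (put (put (del A a) o) o', L) s ∧
        s.nat 4 0 = (if I (put (put (del A a) o) o') then 1 else 0) ∧ s.real 5 0 = f (del A a) ∧
        s.real 6 0 = f (put (del A a) o) ∧ s.real 7 0 = f (put (put (del A a) o) o')) := by
  refine Maps.of_straight (by simp [probeProgram, Program.Straight]) ?_
  rintro s ⟨⟨⟨⟨h0, h1, rfl, rfl, h5, h6, r1, r2, r3, r4⟩, rfl⟩, rfl⟩, rfl⟩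
  refine ⟨⟨⟨⟨?_, ?_⟩, ?_⟩, ?_⟩, ?_⟩
  · constructor <;> simp [probeProgram, Program.final, NatExpr.eval, h0, h1, h5, h6, r1, r2, r3, r4]
  all_goals simp [probeProgram, Program.final, NatExpr.eval]

theorem maps_commit {N M : ℕ} {y b w τ : ℝ} {B A L : Finset (Fin n)} {a o o' : ℕ} :
    Maps I f ω commitProgram commitProgram.maxCost (RepArgs N M y b w τ B a o o' (A, L))
      (RepArgs N M y b w τ B a o o' (A, put (put (del L a) o) o')) := by
  refine Maps.of_straight (by simp [commitProgram, Program.Straight]) ?_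
  rintro s ⟨⟨⟨⟨h0, h1, rfl, rfl, h5, h6, r1, r2, r3, r4⟩, rfl⟩, rfl⟩, rfl⟩
  refine ⟨⟨⟨?_, ?_⟩, ?_⟩, ?_⟩
  · constructor <;>
      simp [commitProgram, Program.final, NatExpr.eval, h0, h1, h5, h6, r1, r2, r3, r4]
  all_goals simp [commitProgram, Program.final, NatExpr.eval]

theorem maps_undo {N M : ℕ} {y b w τ : ℝ} {B A L : Finset (Fin n)} {a o o' : ℕ} :
    Maps I f ω undoProgram undoProgram.maxCost (RepArgs N M y b w τ B a o o' (A, L))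
      (RepArgs N M y b w τ B a o o' (put (del (del A o) o') a, L)) := by
  refine Maps.of_straight (by simp [undoProgram, Program.Straight]) ?_
  rintro s ⟨⟨⟨⟨h0, h1, rfl, rfl, h5, h6, r1, r2, r3, r4⟩, rfl⟩, rfl⟩, rfl⟩
  refine ⟨⟨⟨?_, ?_⟩, ?_⟩, ?_⟩
  · constructor <;>
      simp [undoProgram, Program.final, NatExpr.eval, h0, h1, h5, h6, r1, r2, r3, r4]
  all_goals simp [undoProgram, Program.final, NatExpr.eval]

theorem maps_attempt {N M : ℕ} {y b w τ : ℝ} {B : Finset (Fin n)} {a o o' : ℕ}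
    (ho : o < n) (ho' : o' < n) (X : Finset (Fin n) × Finset (Fin n)) :
    Maps I f ω attemptProgram 200 (RepArgs N M y b w τ B a o o' X)
      (RepArgs N M y b w τ B a o o' (attempt I f τ a o o' X)) := by
  obtain ⟨A, L⟩ := X
  have hguard : ∀ s, RepArgs N M y b w τ B a o o' (A, L) s → (guardTest.Holds s ↔
      ((n ≤ a ∧ o = o') ∨ (¬ n ≤ a ∧ o ≠ o' ∧ Has A a ∧ Has L a)) ∧ ¬ Has A o ∧ ¬ Has A o') := by
    intro s hs
    rw [guardTest_holds hs.1.1.1.size hs.1.1.2 hs.1.2 hs.2 ho ho', hs.1.1.1.current,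
      hs.1.1.1.removable]
  have hcost : guardTest.cost + (probeProgram.maxCost + (acceptTest.cost +
      (commitProgram.maxCost + undoProgram.maxCost)) + 1) ≤ 200 := by decide
  refine Maps.mono (Maps.ite ?_ ?_) hcost (fun s hs => hs) (fun s hs => hs)
  · by_cases hg : ((n ≤ a ∧ o = o') ∨ (¬ n ≤ a ∧ o ≠ o' ∧ Has A a ∧ Has L a)) ∧
        ¬ Has A o ∧ ¬ Has A o'
    · refine Maps.seq (maps_probe.mono le_rfl (fun s hs => hs.1) fun s hs => hs) (Maps.ite ?_ ?_)
      · intro s ⟨⟨h, h4, h5, h6, h7⟩, hacc⟩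
        have hA : Acceptable I f τ a o o' (A, L) := by
          refine ⟨hg, ?_⟩
          simpa [acceptTest, Test.Holds, NatExpr.eval, RealExpr.eval, h.1.1.1.threshold, h4, h5, h6,
            h7, h.1.2, h.2] using hacc
        rw [attempt, if_pos hA]
        exact maps_commit s h
      · intro s ⟨⟨h, h4, h5, h6, h7⟩, hacc⟩
        have hA : ¬ Acceptable I f τ a o o' (A, L) := by
          refine fun hA => hacc ?_
          simpa [acceptTest, Test.Holds, NatExpr.eval, RealExpr.eval, h.1.1.1.threshold, h4, h5, h6,
            h7, h.1.2, h.2] using hA.2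
        rw [attempt, if_neg hA]
        have hu := put_del_del (A := A) (a := a)
          (hg.1.imp (fun h => h.1) (fun h => h.2.2.1)) hg.2.1 hg.2.2
        have := maps_undo (I := I) (f := f) (ω := ω) s h
        rwa [hu] at this
    · exact fun s hs => absurd ((hguard s hs.1).1 hs.2) hg
  · intro s ⟨hs, hg⟩
    rw [hguard s hs] at hg
    rw [attempt, if_neg fun h => hg h.1]
    exact ⟨s, _, .skip s, le_rfl, hs⟩

theorem maps_scan {N M : ℕ} {y b w τ : ℝ} {B : Finset (Fin n)}
    (X : Finset (Fin n) × Finset (Fin n)) :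
    Maps I f ω scanProgram ((n + 2) * ((n + 1) * ((n + 1) * 222 + 22) + 24))
      (Rep N M y b w τ B X.1 X.2)
      (Rep N M y b w τ B (scan I f τ X).1 (scan I f τ X).2) := by
  have h1 := fun (a o : ℕ) (X : Finset (Fin n) × Finset (Fin n)) (ho : o < n) =>
    Maps.for (I := I) (f := f) (ω := ω) (α := Finset (Fin n) × Finset (Fin n))
      (R := fun X s => (Rep N M y b w τ B X.1 X.2 s ∧ s.nat 10 0 = a) ∧ s.nat 11 0 = o)
      (fun o' => attempt I f τ a o o') (N := n) (x := 12) (bound := cell 0) (p := attemptProgram)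
      (by decide) (fun X s h => h.1.1.size)
      (fun X s v h => ⟨⟨h.1.1.setNat 12 _ _ (by norm_num), by simpa using h.1.2⟩,
        by simpa using h.2⟩)
      (fun o' X ho' => (maps_attempt ho ho' X).mono le_rfl (fun s h => h) (fun s h => h.1)) X
  have h2 := fun (a : ℕ) (X : Finset (Fin n) × Finset (Fin n)) =>
    Maps.for (I := I) (f := f) (ω := ω) (α := Finset (Fin n) × Finset (Fin n))
      (R := fun X s => Rep N M y b w τ B X.1 X.2 s ∧ s.nat 10 0 = a)
      (fun o => iterate (fun o' => attempt I f τ a o o') n) (N := n) (x := 11) (bound := cell 0)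
      (p := .for 12 (cell 0) attemptProgram) (by decide) (fun X s h => h.1.size)
      (fun X s v h => ⟨h.1.setNat 11 _ _ (by norm_num), by simpa using h.2⟩)
      (fun o X ho => (h1 a o X ho).mono le_rfl (fun s h => h) (fun s h => h.1)) X
  exact Maps.for (α := Finset (Fin n) × Finset (Fin n))
    (R := fun X s => Rep N M y b w τ B X.1 X.2 s)
    (fun a => iterate (fun o => iterate (fun o' => attempt I f τ a o o') n) n) (N := n + 1)
    (x := 10) (by decide) (fun X s h => congrArg (· + 1) h.size)
    (fun X s v h => h.setNat 10 _ _ (by norm_num))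
    (fun a X _ => (h2 a X).mono le_rfl (fun s h => h) (fun s h => h.1)) X

theorem iterate_del (A : Finset (Fin n)) (m : ℕ) (hm : n ≤ m) :
    iterate (fun i A => del A i) m A = ∅ := by
  have key : ∀ (m : ℕ) (e : Fin n), (e : ℕ) < m → e ∉ iterate (fun i A => del A i) m A := by
    intro m
    induction m with
    | zero => exact fun e he => absurd he (Nat.not_lt_zero _)
    | succ m ih =>
      intro e he
      simp only [iterate, mem_del, not_and, not_not]
      intro h
      by_contra hne
      exact ih e (by omega) h
  exact Finset.eq_empty_of_forall_notMem fun e => key m e (by omega)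

theorem maps_clear_removable {N M : ℕ} {y b w τ : ℝ} {B A L : Finset (Fin n)} :
    Maps I f ω (clearProgram 3) ((n + 1) * 27)
      (Rep N M y b w τ B A L) (Rep N M y b w τ B A ∅) := by
  have h := Maps.for (I := I) (f := f) (ω := ω) (R := fun L s => Rep N M y b w τ B A L s)
    (fun i L => del L i) (N := n) (x := 13) (bound := cell 0)
    (p := .assignNat 3 (cell 13) (.const 0)) (T := 4) (by decide) (fun X s h => h.size)
    (fun X s v h => h.setNat 13 _ _ (by norm_num)) ?_ L
  · rw [iterate_del _ _ le_rfl] at h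
    exact h.mono (by simp [NatExpr.cost]) (fun s h => h) (fun s h => h)
  · intro i X _
    refine Maps.of_straight trivial fun s ⟨⟨h0, h1, h2, h3, h5, h6, r1, r2, r3, r4⟩, hi⟩ => ?_
    constructor <;> simp [Program.final, NatExpr.eval, h0, h1, h2, h3, h5, h6, r1, r2, r3, r4, hi]

theorem maps_clear_current {N M : ℕ} {y b w τ : ℝ} {B A L : Finset (Fin n)} :
    Maps I f ω (clearProgram 2) ((n + 1) * 27)
      (Rep N M y b w τ B A L) (Rep N M y b w τ B ∅ L) := by
  have h := Maps.for (I := I) (f := f) (ω := ω) (R := fun A s => Rep N M y b w τ B A L s)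
    (fun i A => del A i) (N := n) (x := 13) (bound := cell 0)
    (p := .assignNat 2 (cell 13) (.const 0)) (T := 4) (by decide) (fun X s h => h.size)
    (fun X s v h => h.setNat 13 _ _ (by norm_num)) ?_ A
  · rw [iterate_del _ _ le_rfl] at h
    exact h.mono (by simp [NatExpr.cost]) (fun s h => h) (fun s h => h)
  · intro i X _
    refine Maps.of_straight trivial fun s ⟨⟨h0, h1, h2, h3, h5, h6, r1, r2, r3, r4⟩, hi⟩ => ?_
    constructor <;> simp [Program.final, NatExpr.eval, h0, h1, h2, h3, h5, h6, r1, r2, r3, r4, hi]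

open Classical in
theorem iterate_copy (A B : Finset (Fin n)) :
    iterate (fun i B => if Has A i then put B i else del B i) n B = A := by
  have key : ∀ (m : ℕ) (e : Fin n), (e : ℕ) < m →
      (e ∈ iterate (fun i B => if Has A i then put B i else del B i) m B ↔ e ∈ A) := by
    intro m
    induction m with
    | zero => exact fun e he => absurd he (Nat.not_lt_zero _)
    | succ m ih =>
      intro e he
      simp only [iterate]
      rcases Nat.lt_succ_iff_lt_or_eq.1 he with h | rfl
      · split_ifs <;> simp [ih e h, h.ne]
      · rw [has_val]
        split_ifs with h <;> simp [h]
  ext e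
  exact key n e e.2

theorem maps_copy {N M : ℕ} {y b w τ : ℝ} {B A L : Finset (Fin n)} :
    Maps I f ω copyProgram ((n + 1) * 30)
      (Rep N M y b w τ B A L) (Rep N M y b w τ A A L) := by
  classical
  have h := Maps.for (I := I) (f := f) (ω := ω) (R := fun B s => Rep N M y b w τ B A L s)
    (fun i B => if Has A i then put B i else del B i) (N := n) (x := 13) (bound := cell 0)
    (p := .assignNat 1 (cell 13) (.get 2 (cell 13))) (T := 6) (by decide) (fun X s h => h.size)
    (fun X s v h => h.setNat 13 _ _ (by norm_num)) ?_ B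
  · rw [iterate_copy] at h
    exact h.mono (by simp [NatExpr.cost]) (fun s h => h) (fun s h => h)
  · intro i X hi
    refine Maps.of_straight trivial fun s ⟨⟨h0, h1, h2, h3, h5, h6, r1, r2, r3, r4⟩, hi'⟩ => ?_
    have hA : Has A i ↔ ¬ s.nat 2 i = 0 := by rw [← h2, has_storedSet hi]
    constructor <;>
      simp [Program.final, NatExpr.eval, h0, h1, h2, h3, h5, h6, r1, r2, r3, r4, hi', hA]

theorem maps_search {N M : ℕ} {y b w τ : ℝ} {B A L : Finset (Fin n)} :
    Maps I f ω searchProgram ((n + 1) * 27 +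
        (n + 2) * ((n + 2) * ((n + 1) * ((n + 1) * 222 + 22) + 24) + 24))
      (Rep N M y b w τ B A L) (Rep N M y b w τ B (search I f τ A).1 (search I f τ A).2) := by
  have h := Maps.for (I := I) (f := f) (ω := ω)
    (R := fun X s => Rep N M y b w τ B X.1 X.2 s)
    (fun _ => scan I f τ) (N := n + 1) (x := 14) (bound := .add (cell 0) (.const 1))
    (p := scanProgram) (by decide) (fun X s h => congrArg (· + 1) h.size)
    (fun X s v h => h.setNat 14 _ _ (by norm_num))
    (fun i X _ => (maps_scan X).mono le_rfl (fun s h => h.1) (fun s h => h)) (A, ∅)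
  exact Maps.seq maps_clear_removable h

theorem Maps.exists {α : Sort*} {p : Program} {T : ℕ} {R : α → State → Prop} {R' : State → Prop}
    (h : ∀ a, Maps I f ω p T (R a) R') : Maps I f ω p T (fun s => ∃ a, R a s) R' :=
  fun s ⟨a, hs⟩ => h a s hs

theorem maps_descend {N M : ℕ} {y b w τ : ℝ} {B A L : Finset (Fin n)} :
    Maps I f ω descendProgram (((n + 1) * 27 + 4) + (N + 2) * (((n + 1) * 27 +
        (n + 2) * ((n + 2) * ((n + 1) * ((n + 1) * 222 + 22) + 24) + 24)) + 7 + 24))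
      (Rep N M y b w τ B A L)
      (fun s => ∃ τ' L', Rep N M y b w τ' B (descend I f b w (N + 1)).2 L' s) := by
  have h := Maps.for (I := I) (f := f) (ω := ω)
    (R := fun (X : ℝ × Finset (Fin n)) s => ∃ L', Rep N M y b w X.1 B X.2 L' s)
    (fun _ X => (X.1 / b, (search I f X.1 X.2).1)) (N := N + 1) (x := 15)
    (bound := .add (cell 5) (.const 1))
    (p := .seq searchProgram (setRealCell 4 (.div (realCell 4) (realCell 2)))) (by decide)
    (fun X s ⟨_, h⟩ => congrArg (· + 1) h.levels)
    (fun X s v ⟨_, h⟩ => ⟨_, h.setNat 15 _ _ (by norm_num)⟩)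
    (fun i X _ => Maps.seq (Maps.mono (Maps.exists fun L' => maps_search) le_rfl
      (fun s h => h.1) (fun s h => h)) (Maps.of_straight trivial ?_)) (w, ∅)
  · refine (Maps.seq (Maps.seq maps_clear_current
      (Maps.of_straight (p := setRealCell 4 (realCell 3))
        (R' := fun s => ∃ L', Rep N M y b w w B ∅ L' s) trivial ?_)) h).mono le_rfl (fun s h => h)
      (fun s ⟨L', h⟩ => ⟨_, L', h⟩)
    rintro s ⟨h0, h1, h2, h3, h5, h6, r1, r2, r3, r4⟩
    refine ⟨L, ?_⟩
    constructor <;>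
      simp [Program.final, NatExpr.eval, RealExpr.eval, h0, h1, h2, h3, h5, h6, r1, r2, r3]
  · rintro s ⟨h0, h1, h2, h3, h5, h6, r1, r2, r3, r4⟩
    refine ⟨(search I f X.1 X.2).2, ?_⟩
    constructor <;>
      simp [Program.final, NatExpr.eval, RealExpr.eval, h0, h1, h2, h3, h5, h6, r1, r2, r3, r4]

theorem maps_improve {N M : ℕ} {y b w τ : ℝ} {B A L : Finset (Fin n)} :
    Maps I f ω improveProgram ((((n + 1) * 27 + 4) + (N + 2) * (((n + 1) * 27 +
        (n + 2) * ((n + 2) * ((n + 1) * ((n + 1) * 222 + 22) + 24) + 24)) + 7 + 24)) +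
        (2 + ((5 + ((n + 1) * 30 + 1)) + 7)))
      (Rep N M y b w τ B A L)
      (fun s => ∃ τ' A' L', Rep N M y b (improve I f (N + 1) y b (w, B)).1 τ'
        (improve I f (N + 1) y b (w, B)).2 A' L' s) := by
  set D := (descend I f b w (N + 1)).2 with hD
  refine Maps.seq maps_descend (Maps.seq (T := 2) (R' := fun s => (∃ τ' L',
    Rep N M y b w τ' B D L' s) ∧ s.real 5 0 = f B ∧ s.real 6 0 = f D)
    (Maps.of_straight (by simp [Program.Straight]) ?_)
    (Maps.seq (T' := 7) (R' := fun s => ∃ τ' A' L',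
      Rep N M y b w τ' (improve I f (N + 1) y b (w, B)).2 A' L' s) ?_
      (Maps.of_straight trivial ?_)))
  · rintro s ⟨τ', L', h0, h1, h2, h3, h5, h6, r1, r2, r3, r4⟩
    refine ⟨⟨τ', L', ?_⟩, ?_, ?_⟩
    · constructor <;> simp [Program.final, h0, h1, h2, h3, h5, h6, r1, r2, r3, r4, hD]
    · simp [Program.final, h1]
    · simp [Program.final, h2, hD]
  · refine Maps.ite ?_ ?_
    · rintro s ⟨⟨⟨τ', L', h⟩, h5, h6⟩, hb⟩
      simp only [Test.Holds, RealExpr.eval, NatExpr.eval, h5, h6] at hb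
      simp only [improve, ← hD, if_pos hb]
      obtain ⟨s', t, he, ht, hs⟩ := maps_copy (I := I) (f := f) (ω := ω) s h
      exact ⟨s', t, he, ht, _, _, _, hs⟩
    · rintro s ⟨⟨⟨τ', L', h⟩, h5, h6⟩, hb⟩
      simp only [Test.Holds, RealExpr.eval, NatExpr.eval, h5, h6] at hb
      simp only [improve, ← hD, if_neg hb]
      exact ⟨s, _, .skip s, le_rfl, _, _, _, h⟩
  · rintro s ⟨τ', A', L', h0, h1, h2, h3, h5, h6, r1, r2, r3, r4⟩
    refine ⟨τ', A', L', ?_⟩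
    constructor <;> simp [Program.final, NatExpr.eval, RealExpr.eval, h0, h1, h2, h3, h5, h6, r1,
      r2, r3, r4, improve]

/-- A bound for the running time of `bestSetProgram`. -/
def bestSetCost {R : Type*} [CommSemiring R] (n N M : R) : R :=
  (n + 1) * (((n + 1) * 27 + 13) + (M + 1) * (((((n + 1) * 27 + 4) + (N + 2) * (((n + 1) * 27 +
        (n + 2) * ((n + 2) * ((n + 1) * ((n + 1) * 222 + 22) + 24) + 24)) + 7 + 24)) +
        (2 + ((5 + ((n + 1) * 30 + 1)) + 7))) + 22) + 22)

theorem maps_bestSet {N M : ℕ} {y b : ℝ} :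
    Maps I f ω bestSetProgram (bestSetCost n N M)
      (fun s => ∃ w τ, Rep N M y b w τ (∅ : Finset (Fin n)) ∅ ∅ s)
      (fun s => s.storedSet n 1 = bestSet I f (N + 1) M y b) := by
  have h1 := fun w B => Maps.for (I := I) (f := f) (ω := ω)
    (R := fun (X : ℝ × Finset (Fin n)) s => ∃ τ A L, Rep N M y b X.1 τ X.2 A L s)
    (fun _ => improve I f (N + 1) y b) (N := M) (x := 16) (bound := cell 6)
    (p := improveProgram) (by decide) (fun X s ⟨_, _, _, h⟩ => h.trials)
    (fun X s v ⟨_, _, _, h⟩ => ⟨_, _, _, h.setNat 16 _ _ (by norm_num)⟩)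
    (fun i X _ => Maps.mono (Maps.exists fun τ => Maps.exists fun A => Maps.exists fun L =>
      maps_improve) le_rfl (fun s h => h.1) (fun s h => h)) (w, B)
  have h := Maps.for (I := I) (f := f) (ω := ω)
    (R := fun (B : Finset (Fin n)) s => ∃ w τ A L, Rep N M y b w τ B A L s)
    (fun e B => (iterate (fun _ => improve I f (N + 1) y b) M (f (put ∅ e) - f ∅, B)).2)
    (N := n) (x := 17) (bound := cell 0) (p := .seq
    (.seq (clearProgram 2) (.seq (.askValue 5 2) (.seq (.assignNat 2 (cell 17) (.const 1))
      (.seq (.askValue 6 2) (setRealCell 3 (.sub (realCell 6) (realCell 5)))))))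
    (.for 16 (cell 6) improveProgram)) (by decide) (fun X s ⟨_, _, _, _, h⟩ => h.size)
    (fun X s v ⟨_, _, _, _, h⟩ => ⟨_, _, _, _, h.setNat 17 _ _ (by norm_num)⟩)
    (fun e B _ => Maps.seq (Maps.seq (T := (n + 1) * 27) (R' := fun s => (∃ w τ L, Rep N M y b w τ B ∅ L s) ∧
      s.nat 17 0 = e) ?_
      (Maps.of_straight (by simp [Program.Straight]) ?_))
      ((h1 (f (put ∅ e) - f ∅) B).mono le_rfl (fun s h => h) (fun s ⟨τ, A, L, h⟩ => ⟨_, τ, A, L, h⟩)))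
    ∅
  · exact h.mono le_rfl (fun s ⟨w, τ, h⟩ => ⟨w, τ, ∅, ∅, h⟩) (fun s ⟨w, τ, A, L, h⟩ => h.best)
  · rintro s ⟨⟨w, τ, A, L, h⟩, he⟩
    obtain ⟨s', t, hex, ht, hs⟩ := maps_clear_current (I := I) (f := f) (ω := ω) s h
    exact ⟨s', t, hex, ht, ⟨_, _, _, hs⟩, by rw [hex.nat_eq (by decide), he]⟩
  · rintro s ⟨⟨w, τ, L, h0, h1, h2, h3, h5, h6, r1, r2, r3, r4⟩, he⟩
    refine ⟨τ, put ∅ e, L, ?_⟩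
    constructor <;> simp [Program.final, NatExpr.eval, RealExpr.eval, h0, h1, h2, h3, h5, h6, r1,
      r2, r4, he]

/-- The properties of the parameters of the algorithm: the number `N` of thresholds in a geometric
progression with the ratio `(1 + 1 / N) ^ M`, which is just above `2`. -/
structure Parameters (n : ℕ) (ε : ℝ) (N M : ℕ) : Prop where
  lt : n < N
  le_mul : (n : ℝ) ≤ N * ε
  le : ∀ m : ℕ, n < m → (n : ℝ) ≤ m * ε → N ≤ m
  two_le : (2 : ℝ) ≤ (1 + 1 / N) ^ M
  lt_two : ∀ m < M, (1 + 1 / N : ℝ) ^ m < 2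

theorem exists_parameters (n : ℕ) {ε : ℝ} (hε : 0 < ε) : ∃ N M, Parameters n ε N M := by
  classical
  have hN : ∃ N : ℕ, n < N ∧ (n : ℝ) ≤ N * ε := by
    obtain ⟨m, hm⟩ := exists_nat_ge ((n : ℝ) / ε)
    refine ⟨max m (n + 1), by simp, ?_⟩
    rw [div_le_iff₀ hε] at hm
    exact hm.trans (mul_le_mul_of_nonneg_right (by exact_mod_cast le_max_left _ _) hε.le)
  have hpos : (0 : ℝ) < Nat.find hN := by
    exact_mod_cast (Nat.zero_le n).trans_lt (Nat.find_spec hN).1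
  have hM : ∃ M : ℕ, (2 : ℝ) ≤ (1 + 1 / (Nat.find hN : ℝ)) ^ M := by
    obtain ⟨M, hM⟩ := pow_unbounded_of_one_lt (2 : ℝ)
      (show 1 < 1 + 1 / (Nat.find hN : ℝ) by linarith [one_div_pos.2 hpos])
    exact ⟨M, hM.le⟩
  exact ⟨Nat.find hN, Nat.find hM, (Nat.find_spec hN).1, (Nat.find_spec hN).2,
    fun m h1 h2 => Nat.find_min' hN ⟨h1, h2⟩, Nat.find_spec hM,
    fun m hm => not_le.1 (Nat.find_min hM hm)⟩

namespace Parameters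

variable {ε : ℝ} {N M : ℕ}

theorem pos (h : Parameters n ε N M) : (0 : ℝ) < N := by
  exact_mod_cast (Nat.zero_le n).trans_lt h.lt

/-- Bernoulli's inequality gives `(1 + 1 / N) ^ N ≥ 2`, and `M` is the first such exponent. -/
theorem M_le (h : Parameters n ε N M) : M ≤ N := by
  by_contra! hlt
  have h1 := h.lt_two N hlt
  have h2 := one_add_mul_le_pow (a := (1 / N : ℝ)) (by linarith [one_div_pos.2 h.pos]) N
  rw [mul_one_div_cancel h.pos.ne'] at h2
  linarith

/-- If the bound failed, `N - 1` would satisfy both conditions of which `N` is the least solution.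
-/
theorem N_le (h : Parameters n ε N M) (hε : 0 < ε) : (N : ℝ) ≤ n + 1 + n * ε⁻¹ := by
  by_contra! hlt
  have hn : (0 : ℝ) ≤ n * ε⁻¹ := by positivity
  have h1 : n + 1 < N := by
    have : ((n + 1 : ℕ) : ℝ) < N := by
      push_cast
      linarith
    exact_mod_cast this
  have h2 : ((N - 1 : ℕ) : ℝ) = N - 1 := by
    rw [Nat.cast_sub (by omega), Nat.cast_one]
  have h3 := h.le (N - 1) (by omega) (by
    rw [h2]
    have : (n : ℝ) * ε⁻¹ ≤ N - 1 := by linarith [(Nat.cast_nonneg n : (0 : ℝ) ≤ n)]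
    calc (n : ℝ) = n * ε⁻¹ * ε := by rw [inv_mul_cancel_right₀ hε.ne']
      _ ≤ _ := mul_le_mul_of_nonneg_right this hε.le)
  omega

end Parameters

/-- The machine can neither round reals nor take logarithms, so `N` and `M` are found by counting
upwards: `N` from `n + 1`, and `M` while multiplying by `1 + 1 / N` until the power reaches `2`. -/
theorem maps_parameters {ε : ℝ} {N M : ℕ} (hP : Parameters n ε N M) :
    Maps I f ω parameterProgram (100 * (N + 1))
      (fun s => s = init n ε)
      (fun s => ∃ w τ, Rep N M (1 + 1 / N) ((1 + 1 / N) ^ M) w τ (∅ : Finset (Fin n)) ∅ ∅ s) := by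
  have hloop : Maps I f ω _ _ _ _ := Maps.while (I := I) (f := f) (ω := ω)
    (b := .neg (.realLe (.ofNat (cell 0)) (.mul (.ofNat (cell 5)) (realCell 0))))
    (p := .assignNat 5 (.const 0) (.add (cell 5) (.const 1))) (T := 6) (N := N)
    (R := fun i s => (∃ w τ, Rep (n + 1 + i) 0 0 0 w τ (∅ : Finset (Fin n)) ∅ ∅ s) ∧
      s.real 0 0 = ε ∧ n + 1 + i ≤ N)
    (R' := fun s => (∃ w τ, Rep N 0 0 0 w τ (∅ : Finset (Fin n)) ∅ ∅ s)) ?_ ?_ ?_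
  · have hloop' := Maps.while (I := I) (f := f) (ω := ω)
      (b := .neg (.realLe (.ofNat (.const 2)) (realCell 2)))
      (p := .seq (setRealCell 2 (.mul (realCell 2) (realCell 1)))
        (.assignNat 6 (.const 0) (.add (cell 6) (.const 1)))) (T := 13) (N := M)
      (R := fun i s => (∃ w τ, Rep N i (1 + 1 / N) ((1 + 1 / N) ^ i) w τ
        (∅ : Finset (Fin n)) ∅ ∅ s) ∧ i ≤ M)
      (R' := fun s => (∃ w τ, Rep N M (1 + 1 / N) ((1 + 1 / N) ^ M) w τ
        (∅ : Finset (Fin n)) ∅ ∅ s)) ?_ ?_ ?_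
    · refine Maps.mono (Maps.seq (Maps.seq (T := 6)
        (Maps.of_straight trivial ?_) hloop) (Maps.seq (T := 15)
        (Maps.of_straight (p := .seq (setRealCell 1 (.add (.ofNat (.const 1))
          (.div (.ofNat (.const 1)) (.ofNat (cell 5))))) (setRealCell 2 (.ofNat (.const 1))))
          ⟨trivial, trivial⟩ ?_) hloop')) ?_ (fun s h => h) (fun s h => h)
      · rintro s rfl
        refine ⟨⟨0, 0, ?_⟩, ?_, ?_⟩
        · constructor <;> simp [Program.final, init, NatExpr.eval, State.storedSet]
        · simp [Program.final, init]
        · exact hP.lt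
      · rintro s ⟨w, τ, h0, h1, h2, h3, h5, h6, r1, r2, r3, r4⟩
        refine ⟨⟨w, τ, ?_⟩, Nat.zero_le _⟩
        constructor <;> simp [Program.final, NatExpr.eval, RealExpr.eval, h0, h1, h2, h3, h5, h6,
          r3, r4]
      · have := hP.M_le
        simp only [Test.cost, RealExpr.cost, NatExpr.cost]
        omega
    · rintro i s ⟨⟨⟨w, τ, h0, h1, h2, h3, h5, h6, r1, r2, r3, r4⟩, hi⟩, hb⟩
      refine (Maps.of_straight (I := I) (f := f) (ω := ω) (R := fun s' => s' = s)
        (by simp [Program.Straight]) ?_).mono (by decide) (fun s h => h) (fun s h => h) s rfl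
      rintro s rfl
      refine ⟨⟨w, τ, ?_⟩, ?_⟩
      · constructor <;> simp [Program.final, NatExpr.eval, RealExpr.eval, h0, h1, h2, h3, h5, h6,
          r1, r2, r3, r4, pow_succ]
      · simp only [Test.Holds, RealExpr.eval, NatExpr.eval, r2] at hb
        refine lt_of_le_of_ne hi fun h => hb ?_
        rw [h]
        exact_mod_cast hP.two_le
    · rintro i s ⟨⟨w, τ, h⟩, hi⟩ hb
      simp only [Test.Holds, RealExpr.eval, NatExpr.eval, h.base] at hb
      refine lt_of_le_of_ne hi fun h => hb ?_
      rw [h]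
      exact_mod_cast hP.two_le
    · rintro i s ⟨⟨w, τ, h⟩, hi⟩ hb
      simp only [Test.Holds, RealExpr.eval, NatExpr.eval, h.base, not_not] at hb
      obtain rfl : i = M := le_antisymm hi (not_lt.1 fun h => by
        have := hP.lt_two i h
        push_cast at hb
        linarith)
      exact ⟨w, τ, h⟩
  · rintro i s ⟨⟨⟨w, τ, h0, h1, h2, h3, h5, h6, r1, r2, r3, r4⟩, hε, hi⟩, hb⟩
    refine (Maps.of_straight (I := I) (f := f) (ω := ω) (R := fun s' => s' = s)
      (by simp [Program.Straight]) ?_).mono (by decide) (fun s h => h) (fun s h => h) s rfl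
    rintro s rfl
    refine ⟨⟨w, τ, ?_⟩, ?_, ?_⟩
    · constructor <;> simp [Program.final, NatExpr.eval, h0, h1, h2, h3, h5, h6,
        r1, r2, r3, r4, add_assoc]
    · simpa [Program.final] using hε
    · simp only [Test.Holds, RealExpr.eval, NatExpr.eval, h0, h5, hε] at hb
      refine lt_of_le_of_ne hi fun h => hb ?_
      rw [h]
      exact hP.le_mul
  · rintro i s ⟨⟨w, τ, h⟩, hε, hi⟩ hb
    omega
  · rintro i s ⟨⟨w, τ, h⟩, hε, hi⟩ hb
    simp only [Test.Holds, RealExpr.eval, NatExpr.eval, h.size, h.levels, hε, not_not] at hb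
    have := hP.le _ (by omega) hb
    obtain rfl : n + 1 + i = N := by omega
    exact ⟨w, τ, h⟩

/-- The program computes `bestSet`. -/
theorem maps_parity {ε : ℝ} {N M : ℕ} (hP : Parameters n ε N M) :
    Maps I f ω parityProgram (100 * (N + 1) + bestSetCost n N M)
      (fun s => s = init n ε)
      (fun s => s.storedSet n 1 = bestSet I f (N + 1) M (1 + 1 / N) ((1 + 1 / N) ^ M)) :=
  Maps.seq (maps_parameters hP) maps_bestSet

end Correctness

end RealRAM

/-! ### Exchanges in matroids -/

section MatroidExchange

variable {V : Type*}

theorem Matroid.eRk_finset_eq (M : Matroid V) (X : Finset V) : ((M.eRk (X : Set V)).toNat : ℕ∞) = M.eRk X := by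
  refine ENat.natCast_toNat (ne_top_of_le_ne_top ?_ (M.eRk_le_encard X))
  simp

theorem Matroid.toNat_eRk_mono (M : Matroid V) {X Y : Finset V} (h : X ⊆ Y) :
    (M.eRk (X : Set V)).toNat ≤ (M.eRk (Y : Set V)).toNat := by
  have := M.eRk_mono (Finset.coe_subset.2 h)
  rw [← M.eRk_finset_eq X, ← M.eRk_finset_eq Y] at this
  exact_mod_cast this

theorem Matroid.Indep.toNat_eRk {M : Matroid V} {X : Finset V} (h : M.Indep (X : Set V)) :
    (M.eRk (X : Set V)).toNat = X.card := by
  rw [h.eRk_eq_encard]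
  simp

variable [DecidableEq V]

theorem Matroid.toNat_eRk_submodular (M : Matroid V) (X Y : Finset V) :
    (M.eRk ((X ∩ Y : Finset V) : Set V)).toNat + (M.eRk ((X ∪ Y : Finset V) : Set V)).toNat ≤
      (M.eRk (X : Set V)).toNat + (M.eRk (Y : Set V)).toNat := by
  have := M.eRk_inter_add_eRk_union_le (X : Set V) Y
  rw [← Finset.coe_inter, ← Finset.coe_union, ← M.eRk_finset_eq X, ← M.eRk_finset_eq Y,
    ← M.eRk_finset_eq (X ∩ Y), ← M.eRk_finset_eq (X ∪ Y)] at this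
  exact_mod_cast this

variable {M : Matroid V}

/-- An independent subset `C` of a finite set can be extended to a basis, with as many elements as
any other independent subset. -/
theorem Matroid.Indep.exists_finset_basis {C X : Finset V} (hC : M.Indep (C : Set V)) (hCX : C ⊆ X)
    (hX : (X : Set V) ⊆ M.E) :
    ∃ J : Finset V, C ⊆ J ∧ J ⊆ X ∧ M.Indep (J : Set V) ∧ J.card = (M.eRk (X : Set V)).toNat ∧
      ∀ x ∈ X, M.Indep (insert x J : Finset V) → x ∈ J := by
  obtain ⟨J, hJ, hCJ⟩ := hC.subset_isBasis_of_subset (Finset.coe_subset.2 hCX) hX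
  have hfin : J.Finite := X.finite_toSet.subset hJ.subset
  obtain ⟨J, rfl⟩ := hfin.exists_finset_coe
  refine ⟨J, by exact_mod_cast hCJ, by exact_mod_cast hJ.subset, hJ.indep, ?_, fun x hx h => ?_⟩
  · rw [← hJ.encard_eq_eRk]
    simp
  · have := hJ.mem_of_insert_indep (Finset.mem_coe.2 hx) (by simpa using h)
    exact_mod_cast this

/-- Extend `C'` to a basis `J` of `C' ∪ Q` and let `Q' = Q ∩ J`. The rank of `C' ∪ Q` is at least
`|C ∪ Q|`, so growing `C` to `C'` destroys at most one element of `Q` for each new element, and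
maximality of `J` says that no destroyed element can be put back. -/
theorem Matroid.Indep.exists_residual {C C' Q : Finset V} (hQ : M.Indep (C ∪ Q : Finset V))
    (hC : C ⊆ C') (hC' : M.Indep (C' : Set V)) :
    ∃ Q' ⊆ Q, M.Indep (C' ∪ Q' : Finset V) ∧ (Q \ Q').card ≤ (C' \ C).card ∧
      ∀ x ∈ Q, x ∉ Q' → ¬ M.Indep (insert x (C' ∪ Q') : Finset V) := by
  have hE : ((C' ∪ Q : Finset V) : Set V) ⊆ M.E := by
    rw [Finset.coe_union, Set.union_subset_iff]
    refine ⟨hC'.subset_ground, (Finset.coe_subset.2 ?_).trans hQ.subset_ground⟩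
    exact Finset.subset_union_right
  obtain ⟨J, hC'J, hJ, hind, hcard, hmax⟩ :=
    hC'.exists_finset_basis Finset.subset_union_left hE
  have hJeq : C' ∪ (Q ∩ J) = J := by
    ext x
    have h1 := @hC'J x
    have h2 := @hJ x
    simp only [Finset.mem_union, Finset.mem_inter] at h2 ⊢
    tauto
  refine ⟨Q ∩ J, Finset.inter_subset_left, by rwa [hJeq], ?_, ?_⟩
  · have h1 : (C ∪ Q).card ≤ J.card := by
      rw [hcard, ← hQ.toNat_eRk]
      exact M.toNat_eRk_mono (Finset.union_subset_union_left hC)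
    have h2 : (C ∪ Q).card = C.card + (Q \ C).card := by
      rw [← Finset.card_union_of_disjoint Finset.disjoint_sdiff, Finset.union_sdiff_self_eq_union]
    have h3 : J.card = C'.card + ((Q ∩ J) \ C').card := by
      rw [← Finset.card_union_of_disjoint Finset.disjoint_sdiff, Finset.union_sdiff_self_eq_union,
        hJeq]
    have h4 : (Q \ C).card = (Q \ (Q ∩ J)).card + ((Q ∩ J) \ C).card := by
      rw [← Finset.card_union_of_disjoint]
      · congr 1
        ext x
        have := @hC x
        have := @hC'J x
        simp only [Finset.mem_sdiff, Finset.mem_union, Finset.mem_inter]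
        tauto
      · rw [Finset.disjoint_left]
        intro x hx hx'
        simp only [Finset.mem_sdiff] at hx hx'
        exact hx.2 hx'.1
    have h5 : ((Q ∩ J) \ C').card ≤ ((Q ∩ J) \ C).card :=
      Finset.card_le_card (Finset.sdiff_subset_sdiff le_rfl hC)
    rw [Finset.card_sdiff_of_subset hC]
    omega
  · intro x hx hxJ h
    rw [hJeq] at h
    exact hxJ (Finset.mem_inter.2 ⟨hx, hmax x (Finset.mem_union_right _ hx) h⟩)

/-- A basis of `W ∪ Y` that extends `W` by two elements would contain a pair excluded by `h`. -/
theorem Matroid.toNat_eRk_le_of_forall_not_indep {W Y : Finset V} (hW : M.Indep (W : Set V))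
    (hY : (Y : Set V) ⊆ M.E)
    (h : ∀ y ∈ Y, ∀ y' ∈ Y, y ≠ y' → ¬ M.Indep (insert y (insert y' W) : Finset V)) :
    (M.eRk (W ∪ Y : Finset V)).toNat ≤ W.card + 1 := by
  obtain ⟨J, hWJ, hJ, hind, hcard, -⟩ := hW.exists_finset_basis (X := W ∪ Y)
    Finset.subset_union_left (by
      rw [Finset.coe_union]
      exact Set.union_subset hW.subset_ground hY)
  rw [← hcard]
  by_contra! hlt
  have h1 : 1 < (J \ W).card := by
    rw [Finset.card_sdiff_of_subset hWJ]
    omega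
  obtain ⟨y, hy, y', hy', hne⟩ := Finset.one_lt_card.1 h1
  rw [Finset.mem_sdiff] at hy hy'
  have hmem : ∀ z, z ∈ J ∧ z ∉ W → z ∈ Y := fun z hz =>
    (Finset.mem_union.1 (hJ hz.1)).resolve_left hz.2
  refine h y (hmem y hy) y' (hmem y' hy') hne (hind.subset (Finset.coe_subset.2 ?_))
  exact Finset.insert_subset hy.1 (Finset.insert_subset hy'.1 hWJ)

/-- If an independent set `K ∪ ⋃ a ∈ B, S a` spans `Y`, and remains so close to spanning `Y` after
the removal of any `S a` that no two elements of `Y` can be added, then `Y` has at most as many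
elements as `B`, provided that `K ∪ Y` is independent. -/
theorem Matroid.card_le_of_exchange {E : Type*} [DecidableEq E] {B : Finset E} {S : E → Finset V}
    {K Y : Finset V}
    (hS : ∀ a ∈ B, ∀ a' ∈ B, a ≠ a' → Disjoint (S a) (S a'))
    (hKS : M.Indep (K ∪ B.biUnion S : Finset V)) (hKY : M.Indep (K ∪ Y : Finset V))
    (hdisj : Disjoint K Y)
    (hmax : ∀ y ∈ Y, ¬ M.Indep (insert y (K ∪ B.biUnion S) : Finset V))
    (hpair : ∀ a ∈ B, ∀ y ∈ Y, ∀ y' ∈ Y, y ≠ y' →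
      ¬ M.Indep (insert y (insert y' (K ∪ (B.biUnion S \ S a))) : Finset V)) :
    Y.card ≤ B.card := by
  set U := B.biUnion S with hU
  have hYE : (Y : Set V) ⊆ M.E :=
    (Finset.coe_subset.2 Finset.subset_union_right).trans hKY.subset_ground
  have hspan : (M.eRk (K ∪ U ∪ Y : Finset V)).toNat ≤ (K ∪ U).card := by
    obtain ⟨J, hWJ, hJ, hind, hcard, -⟩ := hKS.exists_finset_basis (X := K ∪ U ∪ Y)
      Finset.subset_union_left (by
        rw [Finset.coe_union]
        exact Set.union_subset hKS.subset_ground hYE)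
    rw [← hcard]
    refine Finset.card_le_card fun y hy => ?_
    by_contra hyn
    exact hmax y ((Finset.mem_union.1 (hJ hy)).resolve_left hyn)
      (hind.subset (Finset.coe_subset.2 (Finset.insert_subset hy hWJ)))
  -- The excess of the rank of `K ∪ (U \ T) ∪ Y` over `|K ∪ (U \ T)|` is zero for `T = ∅` and at
  -- most one for `T = S a`. By submodularity of the rank it is subadditive over disjoint `T`, hence
  -- at most `|B'|` after removing all `S a` with `a ∈ B'`. For `B' = B` this bounds the rank `|K| +
  -- |Y|` of `K ∪ Y`.
  have key : ∀ B' ⊆ B, (M.eRk (K ∪ (U \ B'.biUnion S) ∪ Y : Finset V)).toNat ≤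
      (K ∪ (U \ B'.biUnion S)).card + B'.card := by
    intro B'
    induction B' using Finset.induction_on with
    | empty => simpa using hspan
    | insert a B' ha ih =>
      intro hB'
      have haB := hB' (Finset.mem_insert_self _ _)
      have ih := ih ((Finset.subset_insert _ _).trans hB')
      have hdis : ∀ x ∈ S a, x ∉ B'.biUnion S := by
        intro x hx hx'
        obtain ⟨a', ha', hx'⟩ := Finset.mem_biUnion.1 hx'
        exact Finset.disjoint_left.1 (hS a haB a' (hB' (Finset.mem_insert_of_mem ha'))
          (fun h => ha (h ▸ ha'))) hx hx'
      have h1 : (M.eRk (K ∪ (U \ S a) ∪ Y : Finset V)).toNat ≤ (K ∪ (U \ S a)).card + 1 :=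
        M.toNat_eRk_le_of_forall_not_indep (hKS.subset (Finset.coe_subset.2
          (Finset.union_subset_union_right Finset.sdiff_subset))) hYE (hpair a haB)
      have h2 := M.toNat_eRk_submodular (K ∪ (U \ B'.biUnion S) ∪ Y) (K ∪ (U \ S a) ∪ Y)
      have h3 : (M.eRk (K ∪ (U \ (insert a B').biUnion S) ∪ Y : Finset V)).toNat ≤
          (M.eRk ((K ∪ (U \ B'.biUnion S) ∪ Y) ∩ (K ∪ (U \ S a) ∪ Y) : Finset V)).toNat := by
        refine M.toNat_eRk_mono fun x => ?_
        simp only [Finset.biUnion_insert, Finset.mem_union, Finset.mem_inter, Finset.mem_sdiff]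
        tauto
      have h4 : (K ∪ U).card ≤
          (M.eRk ((K ∪ (U \ B'.biUnion S) ∪ Y) ∪ (K ∪ (U \ S a) ∪ Y) : Finset V)).toNat := by
        rw [← hKS.toNat_eRk]
        refine M.toNat_eRk_mono fun x => ?_
        have := hdis x
        simp only [Finset.mem_union, Finset.mem_sdiff]
        tauto
      have h5 := Finset.card_union_add_card_inter (K ∪ (U \ B'.biUnion S)) (K ∪ (U \ S a))
      have h6 : (K ∪ (U \ B'.biUnion S)) ∪ (K ∪ (U \ S a)) = K ∪ U := by
        ext x
        have := hdis x
        simp only [Finset.mem_union, Finset.mem_sdiff]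
        tauto
      have h7 : (K ∪ (U \ B'.biUnion S)) ∩ (K ∪ (U \ S a)) =
          K ∪ (U \ (insert a B').biUnion S) := by
        ext x
        simp only [Finset.biUnion_insert, Finset.mem_union, Finset.mem_inter, Finset.mem_sdiff]
        tauto
      rw [h6, h7] at h5
      rw [Finset.card_insert_of_notMem ha]
      omega
  have := key B le_rfl
  rw [← hU, sdiff_self, Finset.bot_eq_empty, Finset.union_empty, hKY.toNat_eRk,
    Finset.card_union_of_disjoint hdisj] at this
  omega

end MatroidExchange

/-! ### Local optima of matroid parity constraints -/

namespace MatroidParity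

variable {k : ℕ} {E V : Type*} (I : MatroidParity k E V)

theorem feasible_iff [DecidableEq V] (S : Finset E) :
    I.Feasible S ↔ I.matroid.Indep (S.biUnion I.edge : Finset V) := by
  simp [Feasible]

theorem Feasible.subset {S T : Finset E} (hT : I.Feasible T) (h : S ⊆ T) : I.Feasible S :=
  Matroid.Indep.subset hT (Set.biUnion_subset_biUnion_left h)

theorem feasible_empty : I.Feasible ∅ := by
  simp [Feasible]

variable {I}

/-- The value of a local optimum for rounded weights: `A 0 ⊆ A 1 ⊆ …` are successive solutions,
where the elements of level `j` are added in the step from `A j` to `A (j + 1)` and have the weight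
`θ j`. -/
theorem sum_weight_le_of_locally_optimal [DecidableEq E] {θ : ℕ → ℝ} (hθ : ∀ i, 0 ≤ θ i)
    (hθ2 : ∀ i j, i < j → 2 * θ j ≤ θ i) {L : ℕ} {A : ℕ → Finset E} (hA0 : A 0 = ∅)
    (hA : Monotone A) (hfeas : ∀ i, I.Feasible (A i)) {D O : Finset E} (hD : D ⊆ A L)
    (hO : Disjoint O (A L)) (hDO : I.Feasible (D ∪ O)) {lev : E → ℕ} (hlev : ∀ o ∈ O, lev o < L)
    (hadd : ∀ o ∈ O, ¬ I.Feasible (insert o (A (lev o + 1))))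
    (hswap : ∀ o ∈ O, ∀ o' ∈ O, o ≠ o' → lev o = lev o' → ∀ a ∈ A (lev o + 1), a ∉ A (lev o) →
      ¬ I.Feasible (insert o (insert o' ((A (lev o + 1)).erase a)))) :
    ∑ o ∈ O, θ (lev o) ≤ (k + 1) / 2 * ∑ i ∈ Finset.range L, θ i * ((A (i + 1) \ A i) \ D).card := by
  classical
  set M := I.matroid
  set C : ℕ → Finset V := fun i => (D ∪ A i).biUnion I.edge with hC
  have hCmono : ∀ i, C i ⊆ C (i + 1) := fun i =>
    Finset.biUnion_subset_biUnion_of_subset_left _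
      (Finset.union_subset_union_right (hA (Nat.le_succ i)))
  have hCind : ∀ i, M.Indep (C i : Set V) := by
    intro i
    rw [hC, ← feasible_iff]
    refine (hfeas (max i L)).subset I (Finset.union_subset ?_ ?_)
    · exact hD.trans (hA (le_max_right _ _))
    · exact hA (le_max_left _ _)
  -- `F` contracts one more level; iterating it from all vertices of `O` yields the surviving
  -- vertices `Q i`.
  choose! F hFsub hFind hFcard hFmax using fun (i : ℕ) (Q : Finset V)
    (hQ : M.Indep (C i ∪ Q : Finset V)) =>
    Matroid.Indep.exists_residual hQ (hCmono i) (hCind (i + 1))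
  let Q : ℕ → Finset V := fun i => Nat.rec (O.biUnion I.edge) (fun i q => F i q) i
  have hQ0 : Q 0 = O.biUnion I.edge := rfl
  have hQs : ∀ i, Q (i + 1) = F i (Q i) := fun i => rfl
  have hQind : ∀ i, M.Indep (C i ∪ Q i : Finset V) := by
    intro i
    induction i with
    | zero =>
      rw [hQ0, hC]
      simp only [hA0, Finset.union_empty]
      rw [← Finset.union_biUnion, ← feasible_iff]
      exact hDO
    | succ i ih => exact hFind i _ ih
  have hQsub : ∀ i, Q (i + 1) ⊆ Q i := fun i => hFsub i _ (hQind i)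
  have hcard : ∀ i, (Q i \ Q (i + 1)).card ≤ k * ((A (i + 1) \ A i) \ D).card := by
    intro i
    refine (hFcard i _ (hQind i)).trans ((Finset.card_le_card (t :=
      ((A (i + 1) \ A i) \ D).biUnion I.edge) fun x hx => ?_).trans
      ((Finset.card_biUnion_le_card_mul _ _ k fun e _ => I.card_edge_le e).trans_eq
        (mul_comm _ _)))
    simp only [hC, Finset.mem_sdiff, Finset.mem_biUnion, Finset.mem_union] at hx ⊢
    obtain ⟨⟨e, he, hx⟩, hn⟩ := hx
    push Not at hn
    refine ⟨e, ⟨⟨?_, fun h => hn e (Or.inr h) hx⟩, fun h => hn e (Or.inl h) hx⟩, hx⟩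
    exact he.resolve_left fun h => hn e (Or.inl h) hx
  have hmax : ∀ i, ∀ x ∈ Q i, x ∉ Q (i + 1) →
      ¬ M.Indep (insert x (C (i + 1) ∪ Q (i + 1)) : Finset V) := fun i => hFmax i _ (hQind i)
  clear_value Q
  -- The edges that are only half paid by their vertices: intact up to their own level, and losing a
  -- single vertex there.
  let X : ℕ → Finset E := fun j => O.filter fun o => lev o = j ∧ I.edge o ⊆ Q j ∧
    (I.edge o ∩ (Q j \ Q (j + 1))).card = 1
  have hX : ∀ j < L, (X j).card ≤ ((A (j + 1) \ A j) \ D).card := by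
    intro j hj
    set B := (A (j + 1) \ A j) \ D with hB
    -- `K` is what is kept on both sides of step `j`: adding the vertices of `B` gives `C (j + 1) ∪
    -- Q (j + 1)`, while adding the lost vertices `Y` stays inside `C j ∪ Q j`. Both are
    -- independent, so the exchange lemma compares `Y` with `B`.
    set K := C j ∪ Q (j + 1) with hK
    set R := Q j \ Q (j + 1) with hR
    set Y := (X j).biUnion fun o => I.edge o ∩ R with hY
    have hYcard : Y.card = (X j).card := by
      rw [hY, Finset.card_biUnion, Finset.card_eq_sum_ones]
      · exact Finset.sum_congr rfl fun o ho => (Finset.mem_filter.1 ho).2.2.2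
      · intro o _ o' _ hne
        exact Finset.disjoint_of_subset_left Finset.inter_subset_left
          (Finset.disjoint_of_subset_right Finset.inter_subset_left (I.disjoint_edge o o' hne))
    have hYR : Y ⊆ R := Finset.biUnion_subset.2 fun o _ => Finset.inter_subset_right
    have hKU : K ∪ B.biUnion I.edge = C (j + 1) ∪ Q (j + 1) := by
      have h1 : D ∪ A (j + 1) = D ∪ A j ∪ B := by
        ext e
        have := @hA j (j + 1) (Nat.le_succ j) e
        simp only [hB, Finset.mem_union, Finset.mem_sdiff]
        tauto
      simp only [hK, hC]
      rw [h1, Finset.union_biUnion]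
      rw [Finset.union_right_comm]
      simp only [Finset.union_biUnion]
    have hAj : ∀ o ∈ O, o ∉ D ∪ A j := by
      intro o ho ho'
      refine Finset.disjoint_left.1 hO ho ?_
      exact (Finset.mem_union.1 ho').elim (fun h => hD h) (fun h => hA hj.le h)
    rw [← hYcard]
    refine Matroid.card_le_of_exchange (M := M) (S := I.edge) (K := K)
      (fun a _ a' _ => I.disjoint_edge a a') ?_ ?_ ?_ ?_ ?_
    · rw [hKU]
      exact hQind (j + 1)
    · refine (hQind j).subset (Finset.coe_subset.2 ?_)
      refine Finset.union_subset (Finset.union_subset_union_right (hQsub j)) ?_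
      exact hYR.trans (Finset.sdiff_subset.trans Finset.subset_union_right)
    · rw [Finset.disjoint_right]
      intro y hy hyK
      rcases Finset.mem_union.1 hyK with h | h
      · obtain ⟨o, ho, hyo⟩ := Finset.mem_biUnion.1 hy
        obtain ⟨e, he, hye⟩ := Finset.mem_biUnion.1 h
        have hoO := (Finset.mem_filter.1 ho).1
        refine Finset.disjoint_left.1 (I.disjoint_edge o e fun h => hAj o hoO (h ▸ he))
          (Finset.mem_inter.1 hyo).1 hye
      · exact (Finset.mem_sdiff.1 (hYR hy)).2 h
    · intro y hy
      rw [hKU]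
      exact hmax j y (Finset.mem_sdiff.1 (hYR hy)).1 (Finset.mem_sdiff.1 (hYR hy)).2
    -- All vertices of `o` and `o'` except `y` and `y'` survive in `Q (j + 1) ⊆ K`. So if `y` and
    -- `y'` fit after the removal of `a`, then exchanging `a` for `o` and `o'` is feasible, against
    -- `hswap`.
    · intro a ha y hy y' hy' hne hind
      obtain ⟨o, ho, hyo⟩ := Finset.mem_biUnion.1 hy
      obtain ⟨o', ho', hyo'⟩ := Finset.mem_biUnion.1 hy'
      obtain ⟨hoO, hoj, hoQ, hoR⟩ := Finset.mem_filter.1 ho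
      obtain ⟨hoO', hoj', hoQ', hoR'⟩ := Finset.mem_filter.1 ho'
      have hedge : ∀ o y, I.edge o ⊆ Q j → (I.edge o ∩ R).card = 1 → y ∈ I.edge o ∩ R →
          ∀ x ∈ I.edge o, x = y ∨ x ∈ Q (j + 1) := by
        intro o y h1 h2 h3 x hx
        by_cases hxQ : x ∈ Q (j + 1)
        · exact Or.inr hxQ
        · exact Or.inl (Finset.card_le_one.1 h2.le x
            (Finset.mem_inter.2 ⟨hx, Finset.mem_sdiff.2 ⟨h1 hx, hxQ⟩⟩) y h3)
      have hneo : o ≠ o' := by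
        rintro rfl
        exact hne (Finset.card_le_one.1 hoR.le y hyo y' hyo')
      rw [hB, Finset.mem_sdiff, Finset.mem_sdiff] at ha
      have hsw := hswap o hoO o' hoO' hneo (hoj.trans hoj'.symm) a (by rw [hoj]; exact ha.1.1)
        (by rw [hoj]; exact ha.1.2)
      rw [hoj] at hsw
      refine hsw ?_
      rw [feasible_iff]
      refine hind.subset (Finset.coe_subset.2 (Finset.biUnion_subset.2 fun e he x hx => ?_))
      simp only [Finset.mem_insert, Finset.mem_erase] at he
      simp only [Finset.mem_insert, hK, Finset.mem_union, Finset.mem_sdiff]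
      rcases he with rfl | rfl | ⟨hea, heA⟩
      · have := hedge e y hoQ hoR hyo x hx
        tauto
      · have := hedge e y' hoQ' hoR' hyo' x hx
        tauto
      · by_cases heD : e ∈ D ∪ A j
        · have : x ∈ C j := Finset.mem_biUnion.2 ⟨e, heD, hx⟩
          tauto
        · have h1 : x ∈ B.biUnion I.edge := by
            refine Finset.mem_biUnion.2 ⟨e, ?_, hx⟩
            rw [Finset.mem_union] at heD
            rw [hB, Finset.mem_sdiff, Finset.mem_sdiff]
            tauto
          have h2 : x ∉ I.edge a := Finset.disjoint_left.1 (I.disjoint_edge e a hea) hx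
          tauto
  -- The payment to a vertex: `θ i / 2` if it is destroyed in step `i`. As `Q` decreases, at most
  -- one summand is nonzero.
  let h : V → ℝ := fun x => ∑ i ∈ Finset.range L, if x ∈ Q i \ Q (i + 1) then θ i / 2 else 0
  have hterm : ∀ x i, 0 ≤ (if x ∈ Q i \ Q (i + 1) then θ i / 2 else 0) := by
    intro x i
    split_ifs
    · exact div_nonneg (hθ i) zero_le_two
    · exact le_rfl
  have hh : ∀ x, 0 ≤ h x := fun x => Finset.sum_nonneg fun i _ => hterm x i
  have hhit : ∀ x i, i < L → x ∈ Q i → x ∉ Q (i + 1) → θ i / 2 ≤ h x := by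
    intro x i hi hx hx'
    have := Finset.single_le_sum (f := fun i => if x ∈ Q i \ Q (i + 1) then θ i / 2 else 0)
      (fun i _ => hterm x i) (Finset.mem_range.2 hi)
    rwa [if_pos (Finset.mem_sdiff.2 ⟨hx, hx'⟩)] at this
  have hanti : ∀ i j, i ≤ j → Q j ⊆ Q i := fun i j hij => antitone_nat_of_succ_le hQsub hij
  have hpay : ∀ o ∈ O, θ (lev o) ≤
      ∑ x ∈ I.edge o, h x + if o ∈ X (lev o) then θ (lev o) / 2 else 0 := by
    intro o ho
    have hnn : 0 ≤ (if o ∈ X (lev o) then θ (lev o) / 2 else 0) := by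
      split_ifs
      · exact div_nonneg (hθ _) zero_le_two
      · exact le_rfl
    by_cases hsub : I.edge o ⊆ Q (lev o)
    · have hsum : ((I.edge o ∩ (Q (lev o) \ Q (lev o + 1))).card : ℝ) * (θ (lev o) / 2) ≤
          ∑ x ∈ I.edge o, h x := by
        rw [← nsmul_eq_mul]
        refine (Finset.card_nsmul_le_sum _ h _ fun x hx => ?_).trans
          (Finset.sum_le_sum_of_subset_of_nonneg Finset.inter_subset_left fun x _ _ => hh x)
        rw [Finset.mem_inter, Finset.mem_sdiff] at hx
        exact hhit x _ (hlev o ho) hx.2.1 hx.2.2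
      -- The number of vertices lost at the edge's own level: none contradicts `hadd`, one leaves
      -- half of the weight to the correction for `X`, two or more pay everything.
      rcases Nat.lt_trichotomy (I.edge o ∩ (Q (lev o) \ Q (lev o + 1))).card 1 with hc | hc | hc
      · exfalso
        refine hadd o ho ?_
        rw [feasible_iff]
        refine (hQind (lev o + 1)).subset (Finset.coe_subset.2
          (Finset.biUnion_subset.2 fun e he x hx => ?_))
        rcases Finset.mem_insert.1 he with rfl | he
        · refine Finset.mem_union_right _ ?_
          by_contra hxQ
          have : x ∈ I.edge e ∩ (Q (lev e) \ Q (lev e + 1)) :=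
            Finset.mem_inter.2 ⟨hx, Finset.mem_sdiff.2 ⟨hsub hx, hxQ⟩⟩
          exact absurd (Finset.card_pos.2 ⟨x, this⟩) (by omega)
        · exact Finset.mem_union_left _
            (Finset.mem_biUnion.2 ⟨e, Finset.mem_union_right _ he, hx⟩)
      · rw [if_pos (Finset.mem_filter.2 ⟨ho, rfl, hsub, hc⟩)]
        rw [hc, Nat.cast_one] at hsum
        linarith
      · have : (2 : ℝ) ≤ (I.edge o ∩ (Q (lev o) \ Q (lev o + 1))).card := by exact_mod_cast hc
        nlinarith [hθ (lev o)]
    -- Some vertex was destroyed at an earlier level `i`, and its payment `θ i / 2` already covers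
    -- `θ (lev o)`. This is where the halving of the thresholds is used.
    · obtain ⟨x, hx, hxQ⟩ := Finset.not_subset.1 hsub
      have hx0 : x ∈ Q 0 := by
        rw [hQ0]
        exact Finset.mem_biUnion.2 ⟨o, ho, hx⟩
      have hex : ∃ i < lev o, x ∈ Q i ∧ x ∉ Q (i + 1) := by
        by_contra! hcon
        have : ∀ i ≤ lev o, x ∈ Q i := by
          intro i
          induction i with
          | zero => exact fun _ => hx0
          | succ i ih => exact fun hi => hcon i (by omega) (ih (by omega))
        exact hxQ (this _ le_rfl)
      obtain ⟨i, hi, hxi, hxi'⟩ := hex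
      have h1 := hhit x i (hi.trans (hlev o ho)) hxi hxi'
      have h2 := Finset.single_le_sum (fun x _ => hh x) hx
      have h3 := hθ2 i _ hi
      linarith
  have hsum1 : ∑ o ∈ O, ∑ x ∈ I.edge o, h x ≤
      ∑ i ∈ Finset.range L, k / 2 * (θ i * ((A (i + 1) \ A i) \ D).card) := by
    rw [← Finset.sum_biUnion fun o _ o' _ hne => I.disjoint_edge o o' hne, Finset.sum_comm]
    refine Finset.sum_le_sum fun i _ => ?_
    rw [← Finset.sum_filter, Finset.sum_const, nsmul_eq_mul]
    have h1 : ((O.biUnion I.edge).filter fun x => x ∈ Q i \ Q (i + 1)).card ≤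
        k * ((A (i + 1) \ A i) \ D).card :=
      (Finset.card_le_card fun x hx => (Finset.mem_filter.1 hx).2).trans (hcard i)
    have h2 : (((O.biUnion I.edge).filter fun x => x ∈ Q i \ Q (i + 1)).card : ℝ) ≤
        k * ((A (i + 1) \ A i) \ D).card := by exact_mod_cast h1
    nlinarith [hθ i]
  have hsum2 : (∑ o ∈ O, if o ∈ X (lev o) then θ (lev o) / 2 else 0) ≤
      ∑ i ∈ Finset.range L, 1 / 2 * (θ i * ((A (i + 1) \ A i) \ D).card) := by
    have h1 : (∑ o ∈ O, if o ∈ X (lev o) then θ (lev o) / 2 else 0) =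
        ∑ o ∈ O, ∑ i ∈ Finset.range L, if o ∈ X i then θ i / 2 else 0 := by
      refine Finset.sum_congr rfl fun o ho => ?_
      rw [Finset.sum_eq_single_of_mem (lev o) (Finset.mem_range.2 (hlev o ho))]
      intro i _ hi
      rw [if_neg]
      exact fun h => hi (Finset.mem_filter.1 h).2.1.symm
    rw [h1, Finset.sum_comm]
    refine Finset.sum_le_sum fun i hi => ?_
    rw [← Finset.sum_filter, Finset.sum_const, nsmul_eq_mul]
    have h2 : (O.filter fun o => o ∈ X i).card ≤ ((A (i + 1) \ A i) \ D).card :=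
      (Finset.card_le_card fun x hx => (Finset.mem_filter.1 hx).2).trans
        (hX i (Finset.mem_range.1 hi))
    have h3 : ((O.filter fun o => o ∈ X i).card : ℝ) ≤ ((A (i + 1) \ A i) \ D).card := by
      exact_mod_cast h2
    nlinarith [hθ i]
  have hall := Finset.sum_le_sum hpay
  rw [Finset.sum_add_distrib] at hall
  rw [Finset.mul_sum]
  refine hall.trans ((add_le_add hsum1 hsum2).trans_eq ?_)
  rw [← Finset.sum_add_distrib]
  exact Finset.sum_congr rfl fun i _ => by ring

end MatroidParity

namespace RealRAM

/-! ### Iterations -/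

theorem iterate_induction {α : Type*} {P : α → Prop} {g : ℕ → α → α}
    {N : ℕ} (h : ∀ i < N, ∀ x, P x → P (g i x)) {x : α} (hx : P x) : P (iterate g N x) := by
  induction N with
  | zero => exact hx
  | succ N ih => exact h N (Nat.lt_succ_self N) _ (ih fun i hi => h i (by omega))

/-- If each map fixes the points with a certain property and increases a potential otherwise, then
so does their composition. -/
theorem iterate_progress {α : Type*} {P : α → Prop} {φ : α → ℕ} {g : ℕ → α → α}
    {Fix : ℕ → α → Prop} {N : ℕ} (hP : ∀ i < N, ∀ x, P x → P (g i x))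
    (h : ∀ i < N, ∀ x, P x → (g i x = x ∧ Fix i x) ∨ φ x < φ (g i x)) {x : α} (hx : P x) :
    (iterate g N x = x ∧ ∀ i < N, Fix i x) ∨ φ x < φ (iterate g N x) := by
  induction N with
  | zero => exact Or.inl ⟨rfl, fun i hi => absurd hi (Nat.not_lt_zero i)⟩
  | succ N ih =>
    rcases ih (fun i hi => hP i (by omega)) (fun i hi => h i (by omega)) with ⟨h1, h2⟩ | h1
    · simp only [iterate, h1]
      rcases h N (Nat.lt_succ_self N) x hx with ⟨h3, h4⟩ | h3
      · refine Or.inl ⟨h3, fun i hi => ?_⟩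
        rcases Nat.lt_succ_iff_lt_or_eq.1 hi with hi | rfl
        · exact h2 i hi
        · exact h4
      · exact Or.inr h3
    · right
      simp only [iterate]
      rcases h N (Nat.lt_succ_self N) _ (iterate_induction (N := N) (fun i hi => hP i (by omega)) hx) with ⟨h3, -⟩ | h3
      · rwa [h3]
      · exact h1.trans h3

/-- The potential cannot increase `N` times while staying below `N`, so one of the rounds changes
nothing, and all later rounds repeat it. -/
theorem iterate_fixed {α : Type*} {P : α → Prop} {φ : α → ℕ} {g : α → α} {Fix : α → Prop}
    (hP : ∀ x, P x → P (g x)) (h : ∀ x, P x → (g x = x ∧ Fix x) ∨ φ x < φ (g x)) {N : ℕ}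
    (hφ : ∀ x, P x → φ x < N) {x : α} (hx : P x) : Fix (iterate (fun _ => g) N x) := by
  have hPi : ∀ N, P (iterate (fun _ => g) N x) := fun N =>
    iterate_induction (fun _ _ => hP) hx
  have key : ∀ N, (g (iterate (fun _ => g) N x) = iterate (fun _ => g) N x ∧
      Fix (iterate (fun _ => g) N x)) ∨ N ≤ φ (iterate (fun _ => g) N x) := by
    intro N
    induction N with
    | zero => exact Or.inr (Nat.zero_le _)
    | succ N ih =>
      simp only [iterate]
      rcases ih with h1 | h1
      · left
        rw [h1.1]
        exact h1
      · rcases h _ (hPi N) with h2 | h2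
        · left
          rw [h2.1]
          exact h2
        · right
          omega
  rcases key N with h1 | h1
  · exact h1.2
  · exact absurd (hφ _ (hPi N)) (by omega)

/-! ### Local search -/

section LocalSearch

variable {n : ℕ} {I : Finset (Fin n) → Prop} {f : Finset (Fin n) → ℝ}

theorem put_eq_insert (A : Finset (Fin n)) (e : Fin n) : put A e = insert e A := by
  ext x
  simp [Fin.ext_iff, or_comm]

theorem del_eq_erase (A : Finset (Fin n)) (e : Fin n) : del A e = A.erase e := by
  ext x
  simp [Fin.ext_iff, and_comm]

theorem del_of_le (A : Finset (Fin n)) {a : ℕ} (ha : n ≤ a) : del A a = A := by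
  ext x
  have := x.2
  simp only [mem_del, and_iff_left_iff_imp]
  omega

/-- The invariant of the local search: the second set consists of the elements that were added to
`A₀`, and each of them contributes at least `τ`. -/
structure SearchInvariant (I : Finset (Fin n) → Prop) (f : Finset (Fin n) → ℝ) (A₀ : Finset (Fin n))
    (τ : ℝ) (X : Finset (Fin n) × Finset (Fin n)) : Prop where
  eq_union : X.1 = A₀ ∪ X.2
  disjoint : Disjoint A₀ X.2
  feasible : I X.1
  value : ∀ B ⊆ X.2, f A₀ + τ * B.card ≤ f (A₀ ∪ B)

/-- The bound is kept for all subsets `B` of the added elements because later exchanges remove some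
of them. By submodularity `o` contributes to the smaller set `A₀ ∪ B.erase o` at least what it
contributed to `A`. -/
theorem SearchInvariant.insert_value (hf : IsSubmodular f) {A₀ A L : Finset (Fin n)} {τ : ℝ}
    (hA : A = A₀ ∪ L) (hL : ∀ B ⊆ L, f A₀ + τ * B.card ≤ f (A₀ ∪ B)) {o : Fin n} (ho : o ∉ A)
    (hτ : τ ≤ f (insert o A) - f A) :
    ∀ B ⊆ insert o L, f A₀ + τ * B.card ≤ f (A₀ ∪ B) := by
  intro B hB
  by_cases hoB : o ∈ B
  · have hB' : B.erase o ⊆ L := by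
      intro x hx
      rw [Finset.mem_erase] at hx
      exact Finset.mem_of_mem_insert_of_ne (hB hx.2) hx.1
    have h1 := hL _ hB'
    have h2 := hf (A₀ ∪ B.erase o) A (by rw [hA]; exact Finset.union_subset_union_right hB') o ho
    rw [← Finset.union_insert, Finset.insert_erase hoB] at h2
    rw [← Finset.card_erase_add_one hoB]
    push_cast
    linarith
  · exact hL B fun x hx => Finset.mem_of_mem_insert_of_ne (hB hx) fun h => hoB (h ▸ hx)

/-- The effect of an accepted exchange. -/
theorem acceptable_cases {τ : ℝ} {a o o' : ℕ} (ho : o < n) (ho' : o' < n)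
    {X : Finset (Fin n) × Finset (Fin n)} (h : Acceptable I f τ a o o' X) :
    (∃ u : Fin n, u ∉ X.1 ∧ attempt I f τ a o o' X = (insert u X.1, insert u X.2) ∧
      I (insert u X.1) ∧ τ ≤ f (insert u X.1) - f X.1) ∨
    (∃ c u u' : Fin n, c ∈ X.1 ∧ c ∈ X.2 ∧ u ∉ X.1 ∧ u' ∉ X.1 ∧ u ≠ u' ∧
      attempt I f τ a o o' X =
        (insert u' (insert u (X.1.erase c)), insert u' (insert u (X.2.erase c))) ∧
      I (insert u' (insert u (X.1.erase c))) ∧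
      τ ≤ f (insert u (X.1.erase c)) - f (X.1.erase c) ∧
      τ ≤ f (insert u' (insert u (X.1.erase c))) - f (insert u (X.1.erase c))) := by
  rw [attempt, if_pos h]
  obtain ⟨⟨hcase, hoA, hoA'⟩, hI, h1, h2⟩ := h
  rcases hcase with ⟨ha, rfl⟩ | ⟨ha, hne, haA, haL⟩
  · left
    refine ⟨⟨o, ho⟩, by rwa [has_iff ho] at hoA, ?_⟩
    have hp : ∀ A : Finset (Fin n), put A o = insert ⟨o, ho⟩ A := fun A => put_eq_insert A ⟨o, ho⟩
    simp only [del_of_le _ ha, hp, Finset.insert_idem] at hI h1 ⊢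
    exact ⟨trivial, hI, h1⟩
  · right
    have ha : a < n := not_le.1 ha
    refine ⟨⟨a, ha⟩, ⟨o, ho⟩, ⟨o', ho'⟩, (has_iff ha).1 haA, (has_iff ha).1 haL,
      by rwa [has_iff ho] at hoA, by rwa [has_iff ho'] at hoA', by simpa using hne, ?_⟩
    have hp : ∀ A : Finset (Fin n), put A o = insert ⟨o, ho⟩ A := fun A => put_eq_insert A ⟨o, ho⟩
    have hp' : ∀ A : Finset (Fin n), put A o' = insert ⟨o', ho'⟩ A :=
      fun A => put_eq_insert A ⟨o', ho'⟩
    have hd : ∀ A : Finset (Fin n), del A a = A.erase ⟨a, ha⟩ := fun A => del_eq_erase A ⟨a, ha⟩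
    simp only [hp, hp', hd] at hI h1 h2 ⊢
    exact ⟨trivial, hI, h1, h2.resolve_left hne⟩

theorem SearchInvariant.attempt (hf : IsSubmodular f) {A₀ : Finset (Fin n)} {τ : ℝ} {a o o' : ℕ}
    (ho : o < n) (ho' : o' < n) {X : Finset (Fin n) × Finset (Fin n)}
    (h : SearchInvariant I f A₀ τ X) : SearchInvariant I f A₀ τ (attempt I f τ a o o' X) := by
  by_cases hacc : Acceptable I f τ a o o' X
  · rcases acceptable_cases ho ho' hacc with ⟨u, hu, heq, hI, hv⟩ |
      ⟨c, u, u', hc, hc', hu, hu', hne, heq, hI, hv, hv'⟩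
    · rw [heq]
      refine ⟨?_, ?_, hI, SearchInvariant.insert_value hf h.eq_union h.value hu hv⟩
      · simp [h.eq_union]
      · rw [Finset.disjoint_insert_right]
        exact ⟨fun hA => hu (h.eq_union ▸ Finset.mem_union_left _ hA), h.disjoint⟩
    · rw [heq]
      have hcA : c ∉ A₀ := fun hA => Finset.disjoint_left.1 h.disjoint hA hc'
      have e1 : X.1.erase c = A₀ ∪ X.2.erase c := by
        rw [h.eq_union, Finset.erase_union_distrib, Finset.erase_eq_of_notMem hcA]
      have e2 : insert u (X.1.erase c) = A₀ ∪ insert u (X.2.erase c) := by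
        rw [e1, Finset.union_insert]
      have hu1 : u ∉ X.1.erase c := fun hx => hu (Finset.mem_of_mem_erase hx)
      have hu1' : u' ∉ insert u (X.1.erase c) := by
        rw [Finset.mem_insert]
        rintro (hx | hx)
        · exact hne hx.symm
        · exact hu' (Finset.mem_of_mem_erase hx)
      have v1 := SearchInvariant.insert_value hf e1
        (fun B hB => h.value B (hB.trans (Finset.erase_subset _ _))) hu1 hv
      have v2 := SearchInvariant.insert_value hf e2 v1 hu1' hv'
      refine ⟨?_, ?_, hI, v2⟩
      · simp only [e1, Finset.union_insert]
      · rw [Finset.disjoint_insert_right, Finset.disjoint_insert_right]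
        refine ⟨fun hA => hu' (h.eq_union ▸ Finset.mem_union_left _ hA),
          fun hA => hu (h.eq_union ▸ Finset.mem_union_left _ hA),
          h.disjoint.mono_right (Finset.erase_subset _ _)⟩
  · rwa [RealRAM.attempt, if_neg hacc]

/-- An addition brings one element, an exchange removes one and brings two; either way the set of
removable elements grows by one. This bounds the number of moves without any reference to values. -/
theorem SearchInvariant.attempt_progress {A₀ : Finset (Fin n)} {τ : ℝ} {a o o' : ℕ}
    (ho : o < n) (ho' : o' < n) {X : Finset (Fin n) × Finset (Fin n)}
    (h : SearchInvariant I f A₀ τ X) :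
    (RealRAM.attempt I f τ a o o' X = X ∧ ¬ Acceptable I f τ a o o' X) ∨
      X.2.card < (RealRAM.attempt I f τ a o o' X).2.card := by
  have hsub : X.2 ⊆ X.1 := h.eq_union ▸ Finset.subset_union_right
  by_cases hacc : Acceptable I f τ a o o' X
  · right
    rcases acceptable_cases ho ho' hacc with ⟨u, hu, heq, -⟩ |
      ⟨c, u, u', hc, hc', hu, hu', hne, heq, -⟩
    · rw [heq, Finset.card_insert_of_notMem fun hx => hu (hsub hx)]
      exact Nat.lt_succ_self _
    · have h1 : u ∉ X.2.erase c := fun hx => hu (hsub (Finset.mem_of_mem_erase hx))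
      have h2 : u' ∉ insert u (X.2.erase c) := by
        rw [Finset.mem_insert]
        rintro (hx | hx)
        · exact hne hx.symm
        · exact hu' (hsub (Finset.mem_of_mem_erase hx))
      have h3 := Finset.card_erase_add_one hc'
      rw [heq, Finset.card_insert_of_notMem h2, Finset.card_insert_of_notMem h1]
      omega
  · exact Or.inl ⟨by rw [RealRAM.attempt, if_neg hacc], hacc⟩

theorem SearchInvariant.scan (hf : IsSubmodular f) {A₀ : Finset (Fin n)} {τ : ℝ}
    {X : Finset (Fin n) × Finset (Fin n)} (h : SearchInvariant I f A₀ τ X) :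
    SearchInvariant I f A₀ τ (scan I f τ X) :=
  iterate_induction (fun _ _ _ h => iterate_induction (fun _ ho _ h =>
    iterate_induction (fun _ ho' _ h => h.attempt hf ho ho') h) h) h

theorem SearchInvariant.scan_progress (hf : IsSubmodular f) {A₀ : Finset (Fin n)} {τ : ℝ}
    {X : Finset (Fin n) × Finset (Fin n)} (h : SearchInvariant I f A₀ τ X) :
    (RealRAM.scan I f τ X = X ∧
      ∀ a < n + 1, ∀ o < n, ∀ o' < n, ¬ Acceptable I f τ a o o' X) ∨
      X.2.card < (RealRAM.scan I f τ X).2.card :=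
  iterate_progress (P := SearchInvariant I f A₀ τ) (φ := fun X => X.2.card)
    (Fix := fun a X => ∀ o < n, ∀ o' < n, ¬ Acceptable I f τ a o o' X)
    (fun _ _ _ h => iterate_induction (fun _ ho _ h =>
      iterate_induction (fun _ ho' _ h => h.attempt hf ho ho') h) h)
    (fun a _ _ h => iterate_progress (P := SearchInvariant I f A₀ τ) (φ := fun X => X.2.card)
      (Fix := fun o X => ∀ o' < n, ¬ Acceptable I f τ a o o' X)
      (fun _ ho _ h => iterate_induction (fun _ ho' _ h => h.attempt hf ho ho') h)
      (fun o ho _ h => iterate_progress (P := SearchInvariant I f A₀ τ) (φ := fun X => X.2.card)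
        (Fix := fun o' X => ¬ Acceptable I f τ a o o' X)
        (fun _ ho' _ h => h.attempt hf ho ho')
        (fun _ ho' _ h => h.attempt_progress ho ho') h) h) h

/-- The invariant of the local search holds at its end. -/
theorem searchInvariant_search (hf : IsSubmodular f) {A₀ : Finset (Fin n)} (hA₀ : I A₀) (τ : ℝ) :
    SearchInvariant I f A₀ τ (search I f τ A₀) := by
  refine iterate_induction (fun _ _ _ h => h.scan hf) ⟨by simp, by simp, hA₀, ?_⟩
  intro B hB
  rw [Finset.subset_empty.1 hB]
  simp

/-- The local search ends in a local optimum. -/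
theorem not_acceptable_search (hf : IsSubmodular f) {A₀ : Finset (Fin n)} (hA₀ : I A₀) (τ : ℝ) :
    ∀ a < n + 1, ∀ o < n, ∀ o' < n, ¬ Acceptable I f τ a o o' (search I f τ A₀) := by
  refine iterate_fixed (P := SearchInvariant I f A₀ τ) (φ := fun X => X.2.card)
    (Fix := fun X => ∀ a < n + 1, ∀ o < n, ∀ o' < n, ¬ Acceptable I f τ a o o' X)
    (fun _ h => h.scan hf) (fun _ h => h.scan_progress hf) (fun X _ => ?_)
    ⟨by simp, by simp, hA₀, ?_⟩
  · have := X.2.card_le_univ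
    rw [Fintype.card_fin] at this
    exact Nat.lt_succ_of_le this
  · intro B hB
    rw [Finset.subset_empty.1 hB]
    simp

theorem lt_of_insert_search (hf : IsSubmodular f) {A₀ : Finset (Fin n)} (hA₀ : I A₀) {τ : ℝ}
    {o : Fin n} (ho : o ∉ (search I f τ A₀).1) (hI : I (insert o (search I f τ A₀).1)) :
    f (insert o (search I f τ A₀).1) - f (search I f τ A₀).1 < τ := by
  by_contra! hτ
  -- A plain addition is encoded as the exchange with the nonexistent element `n` and with `o = o'`.
  refine not_acceptable_search hf hA₀ τ n (Nat.lt_succ_self n) o o.2 o o.2 ?_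
  refine ⟨⟨Or.inl ⟨le_rfl, rfl⟩, ?_, ?_⟩, ?_, ?_, Or.inl rfl⟩
  · rwa [has_val]
  · rwa [has_val]
  · rwa [del_of_le _ le_rfl, put_eq_insert, put_eq_insert, Finset.insert_idem]
  · rwa [del_of_le _ le_rfl, put_eq_insert]

theorem lt_of_swap_search (hf : IsSubmodular f) {A₀ : Finset (Fin n)} (hA₀ : I A₀) {τ : ℝ}
    {a o o' : Fin n} (ha : a ∈ (search I f τ A₀).1) (ha₀ : a ∉ A₀)
    (ho : o ∉ (search I f τ A₀).1) (ho' : o' ∉ (search I f τ A₀).1) (hne : o ≠ o')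
    (hI : I (insert o' (insert o ((search I f τ A₀).1.erase a))))
    (hτ : τ ≤ f (insert o ((search I f τ A₀).1.erase a)) - f ((search I f τ A₀).1.erase a)) :
    f (insert o' (insert o ((search I f τ A₀).1.erase a))) -
      f (insert o ((search I f τ A₀).1.erase a)) < τ := by
  by_contra! hτ'
  have hL : a ∈ (search I f τ A₀).2 := by
    rw [(searchInvariant_search hf hA₀ τ).eq_union] at ha
    exact (Finset.mem_union.1 ha).resolve_left ha₀
  refine not_acceptable_search hf hA₀ τ a (by omega) o o.2 o' o'.2 ?_
  refine ⟨⟨Or.inr ⟨not_le.2 a.2, fun h => hne (Fin.ext h), has_val.2 ha, has_val.2 hL⟩,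
    ?_, ?_⟩, ?_, ?_, Or.inr ?_⟩
  · rwa [has_val]
  · rwa [has_val]
  · rwa [del_eq_erase, put_eq_insert, put_eq_insert]
  · rwa [del_eq_erase, put_eq_insert]
  · rwa [del_eq_erase, put_eq_insert, put_eq_insert]

/-! ### Descending thresholds -/

/-- The solution after the local searches with the thresholds `w, …, w / b ^ (i - 1)`. -/
noncomputable def solution (I : Finset (Fin n) → Prop) (f : Finset (Fin n) → ℝ) (b w : ℝ)
    (i : ℕ) : Finset (Fin n) :=
  (descend I f b w i).2

variable {b w : ℝ}

theorem solution_zero : solution I f b w 0 = ∅ := rfl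

theorem solution_succ (i : ℕ) :
    solution I f b w (i + 1) = (search I f (w / b ^ i) (solution I f b w i)).1 := by
  have h : ∀ i, (descend I f b w i).1 = w / b ^ i := by
    intro i
    induction i with
    | zero => simp [descend, iterate]
    | succ i ih =>
      have : (descend I f b w (i + 1)).1 = (descend I f b w i).1 / b := rfl
      rw [this, ih, pow_succ, div_div]
  have : solution I f b w (i + 1) =
    (search I f (descend I f b w i).1 (descend I f b w i).2).1 := rfl
  rw [this, h]
  rfl

theorem solution_feasible (hf : IsSubmodular f) (h0 : I ∅) (i : ℕ) : I (solution I f b w i) := by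
  induction i with
  | zero => exact h0
  | succ i ih =>
    rw [solution_succ]
    exact (searchInvariant_search hf ih _).feasible

theorem solution_mono (hf : IsSubmodular f) (h0 : I ∅) : Monotone (solution I f b w) := by
  refine monotone_nat_of_le_succ fun i => ?_
  rw [solution_succ, (searchInvariant_search hf (solution_feasible hf h0 i) _).eq_union]
  exact Finset.subset_union_left

/-- Each level contributes its threshold once per added element by the search invariant with `B` the
whole level; later levels never remove elements of earlier ones, so these contributions add up. -/
theorem solution_value (hf : IsSubmodular f) (h0 : I ∅) (L : ℕ) :
    f ∅ + ∑ i ∈ Finset.range L,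
      w / b ^ i * (solution I f b w (i + 1) \ solution I f b w i).card ≤
      f (solution I f b w L) := by
  induction L with
  | zero => simp [solution_zero]
  | succ L ih =>
    have h := searchInvariant_search hf (solution_feasible (b := b) (w := w) hf h0 L) (w / b ^ L)
    have h1 := h.value _ le_rfl
    rw [← h.eq_union] at h1
    have h2 : solution I f b w (L + 1) \ solution I f b w L =
        (search I f (w / b ^ L) (solution I f b w L)).2 := by
      rw [solution_succ, h.eq_union, Finset.union_sdiff_cancel_left h.disjoint]
    rw [Finset.sum_range_succ, h2, solution_succ]
    linarith

/-- The first local search collects at least `w` if there is a feasible element of value `w`. -/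
theorem le_solution_of_singleton (hf : IsSubmodular f) (h0 : I ∅) (hb : 0 < b) (hw : 0 ≤ w)
    {e : Fin n} (he : I {e}) (hwe : w ≤ f {e} - f ∅) {L : ℕ} (hL : 0 < L) :
    f ∅ + w ≤ f (solution I f b w L) := by
  refine le_trans ?_ (solution_value hf h0 L)
  have h1 : (solution I f b w 1).Nonempty := by
    rw [Finset.nonempty_iff_ne_empty]
    intro hemp
    have hs := solution_succ (I := I) (f := f) (b := b) (w := w) 0
    rw [zero_add, hemp, solution_zero] at hs
    have := lt_of_insert_search (I := I) hf h0 (τ := w / b ^ 0) (o := e) (by rw [← hs]; simp)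
      (by rw [← hs]; simpa using he)
    rw [← hs, pow_zero, div_one] at this
    simp only [insert_empty_eq] at this
    linarith
  have h2 := Finset.single_le_sum (f := fun i => w / b ^ i *
    ((solution I f b w (i + 1) \ solution I f b w i).card : ℝ)) (fun i _ => by positivity)
    (Finset.mem_range.2 hL)
  have h3 : (1 : ℝ) ≤ (solution I f b w 1 \ solution I f b w 0).card := by
    rw [solution_zero, Finset.sdiff_empty]
    exact_mod_cast h1.card_pos
  simp only [pow_zero, div_one, zero_add] at h2
  nlinarith

end LocalSearch

end RealRAM

namespace RealRAM

/-! ### Rounding down to thresholds -/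

/-- The largest of the thresholds `θ 0, …, θ (L - 1)` that is at most `v`, or `0` if there is none.
The thresholds are decreasing. -/
noncomputable def roundDown (θ : ℕ → ℝ) (L : ℕ) (v : ℝ) : ℝ :=
  open Classical in if ∃ i < L, θ i ≤ v then θ (sInf {i | θ i ≤ v}) else 0

section RoundDown

variable {θ : ℕ → ℝ} {L : ℕ} {v v' : ℝ}

theorem sInf_mem_of_exists (h : ∃ i < L, θ i ≤ v) :
    θ (sInf {i | θ i ≤ v}) ≤ v ∧ sInf {i | θ i ≤ v} < L := by
  obtain ⟨i, hi, hv⟩ := h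
  exact ⟨Nat.sInf_mem (s := {i | θ i ≤ v}) ⟨i, hv⟩,
    (Nat.sInf_le (s := {i | θ i ≤ v}) hv).trans_lt hi⟩

theorem roundDown_nonneg (hθ : ∀ i, 0 ≤ θ i) : 0 ≤ roundDown θ L v := by
  rw [roundDown]
  split_ifs
  exacts [hθ _, le_rfl]

theorem roundDown_le (hv : 0 ≤ v) : roundDown θ L v ≤ v := by
  rw [roundDown]
  split_ifs with h
  exacts [(sInf_mem_of_exists h).1, hv]

theorem le_roundDown (hθ : Antitone θ) {i : ℕ} (hi : i < L) (hv : θ i ≤ v) :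
    θ i ≤ roundDown θ L v := by
  rw [roundDown, if_pos ⟨i, hi, hv⟩]
  exact hθ (Nat.sInf_le (s := {i | θ i ≤ v}) hv)

theorem roundDown_mono (hθ : Antitone θ) (h0 : ∀ i, 0 ≤ θ i) (h : v ≤ v') :
    roundDown θ L v ≤ roundDown θ L v' := by
  by_cases hv : ∃ i < L, θ i ≤ v
  · rw [roundDown, if_pos hv]
    obtain ⟨h1, h2⟩ := sInf_mem_of_exists hv
    exact le_roundDown hθ h2 (h1.trans h)
  · rw [roundDown, if_neg hv]
    exact roundDown_nonneg h0

theorem roundDown_le_of_lt (hθ : Antitone θ) (h0 : ∀ i, 0 ≤ θ i) {i : ℕ}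
    (h : ∀ j < i, v < θ j) : roundDown θ L v ≤ θ i := by
  rw [roundDown]
  split_ifs with hv
  · refine hθ (not_lt.1 fun hlt => ?_)
    exact absurd (sInf_mem_of_exists hv).1 (not_le.2 (h _ hlt))
  · exact h0 i

end RoundDown

/-! ### The value of a solution -/

section Run

variable {n k : ℕ} {V : Type*} {J : MatroidParity k (Fin n) V} {f : Finset (Fin n) → ℝ} {b w : ℝ}

theorem thresholds_antitone (hb : 2 ≤ b) (hw : 0 < w) : Antitone fun i : ℕ => w / b ^ i :=
  antitone_nat_of_succ_le fun i => by
    have h1 : (0 : ℝ) < b ^ i := by positivity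
    have h2 : b ^ i ≤ b ^ (i + 1) := pow_le_pow_right₀ (by linarith) (Nat.le_succ i)
    exact div_le_div_of_nonneg_left hw.le h1 h2

theorem thresholds_pos (hb : 2 ≤ b) (hw : 0 < w) (i : ℕ) : 0 < w / b ^ i := by
  positivity

/-- The reason for requiring `b` to be at least `2`: half of a threshold pays for any lower one. -/
theorem thresholds_halve (hb : 2 ≤ b) (hw : 0 < w) {i j : ℕ} (hij : i < j) :
    2 * (w / b ^ j) ≤ w / b ^ i := by
  refine (mul_le_mul_of_nonneg_left (thresholds_antitone hb hw hij) zero_le_two).trans ?_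
  have h1 : (0 : ℝ) < b ^ i := by positivity
  change 2 * (w / b ^ (i + 1)) ≤ _
  rw [pow_succ, mul_div_assoc', div_le_div_iff₀ (by positivity) h1]
  nlinarith [mul_pos hw h1]

/-- The marginal value of `o` with respect to `A` and the elements of `O` that precede `o`. -/
def marginal (f : Finset (Fin n) → ℝ) (A O : Finset (Fin n)) (o : Fin n) : ℝ :=
  f (insert o (A ∪ O.filter (· < o))) - f (A ∪ O.filter (· < o))

theorem sum_marginal (f : Finset (Fin n) → ℝ) (A O : Finset (Fin n)) :
    ∑ o ∈ O, marginal f A O o = f (A ∪ O) - f A := by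
  induction O using Finset.induction_on_max with
  | empty => simp
  | insert a s hs ih =>
    have ha : a ∉ s := fun h => lt_irrefl _ (hs a h)
    rw [Finset.sum_insert ha]
    have h1 : ∀ o ∈ s, marginal f A (insert a s) o = marginal f A s o := by
      intro o ho
      rw [marginal, Finset.filter_insert, if_neg (hs o ho).asymm]
      rfl
    have h2 : marginal f A (insert a s) a = f (A ∪ insert a s) - f (A ∪ s) := by
      rw [marginal, Finset.filter_insert, if_neg (lt_irrefl a), Finset.filter_true_of_mem hs,
        Finset.union_insert]
    rw [Finset.sum_congr rfl h1, ih, h2]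
    ring

theorem marginal_le (hf : IsSubmodular f) {A O : Finset (Fin n)} {o : Fin n} (ho : o ∉ A)
    {S : Finset (Fin n)} (hS : S ⊆ A ∪ O.filter (· < o)) :
    marginal f A O o ≤ f (insert o S) - f S :=
  hf S _ hS o (by simp [ho])

/-- Elements outside of the solution, with their marginal values rounded down, are worth at most
`(k + 1) / 2` times the elements of the solution with the weights of their levels. -/
theorem sum_roundDown_marginal_le (hf : IsSubmodular f) (hb : 2 ≤ b) (hw : 0 < w) (L : ℕ)
    {O : Finset (Fin n)} (hO : J.Feasible O) :
    ∑ o ∈ O \ solution J.Feasible f b w L, roundDown (fun i => w / b ^ i) L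
        (marginal f (solution J.Feasible f b w L) O o) ≤
      (k + 1) / 2 * ∑ i ∈ Finset.range L, w / b ^ i *
        ((solution J.Feasible f b w (i + 1) \ solution J.Feasible f b w i) \ O).card := by
  classical
  set A := solution J.Feasible f b w with hA
  set θ : ℕ → ℝ := fun i => w / b ^ i with hθ
  have h0 := J.feasible_empty
  have hmono : Monotone A := solution_mono hf h0
  have hfeas : ∀ i, J.Feasible (A i) := solution_feasible hf h0
  have hsucc : ∀ i, A (i + 1) = (search J.Feasible f (θ i) (A i)).1 := fun i => solution_succ i
  set O' := (O \ A L).filter fun o => ∃ i < L, θ i ≤ marginal f (A L) O o with hO'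
  set lev : Fin n → ℕ := fun o => sInf {i | θ i ≤ marginal f (A L) O o} with hlev
  have hmem : ∀ o ∈ O', o ∈ O ∧ o ∉ A L ∧ θ (lev o) ≤ marginal f (A L) O o ∧ lev o < L := by
    intro o ho
    obtain ⟨h1, h2⟩ := Finset.mem_filter.1 ho
    exact ⟨(Finset.mem_sdiff.1 h1).1, (Finset.mem_sdiff.1 h1).2, sInf_mem_of_exists h2⟩
  have hnot : ∀ o ∈ O', o ∉ A (lev o + 1) := fun o ho h =>
    (hmem o ho).2.1 (hmono (hmem o ho).2.2.2 h)
  -- The smaller element must enter first: the marginal of `o'` is taken over a set that contains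
  -- `o`, so submodularity bounds both successive gains of the exchange from below by the common
  -- threshold.
  have hpair : ∀ o ∈ O', ∀ o' ∈ O', o < o' → lev o = lev o' → ∀ a ∈ A (lev o + 1), a ∉ A (lev o) →
      ¬ J.Feasible (insert o' (insert o ((A (lev o + 1)).erase a))) := by
    intro o ho o' ho' hlt heq a ha ha' hJ
    have hsub : (A (lev o + 1)).erase a ⊆ A L :=
      (Finset.erase_subset _ _).trans (hmono (hmem o ho).2.2.2)
    have m1 := marginal_le hf (O := O) (hmem o ho).2.1
      (hsub.trans Finset.subset_union_left)
    have m2 := marginal_le hf (O := O) (S := insert o ((A (lev o + 1)).erase a))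
      (hmem o' ho').2.1 (Finset.insert_subset
        (Finset.mem_union_right _ (Finset.mem_filter.2 ⟨(hmem o ho).1, hlt⟩))
        (hsub.trans Finset.subset_union_left))
    have l1 := (hmem o ho).2.2.1
    have l2 := (hmem o' ho').2.2.1
    have n1 := hnot o ho
    have n2 := hnot o' ho'
    rw [← heq] at l2 n2
    rw [hsucc] at ha n1 n2 hJ m1 m2
    have := lt_of_swap_search hf (hfeas (lev o)) ha ha' n1 n2 hlt.ne hJ (l1.trans m1)
    linarith
  -- Elements common to `O` and the solution form `D`. They are counted neither among the edges to
  -- be paid for nor among the payers.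
  have key := MatroidParity.sum_weight_le_of_locally_optimal (I := J) (θ := θ) (L := L) (A := A)
    (D := O ∩ A L) (O := O') (lev := lev) (fun i => (thresholds_pos hb hw i).le)
    (fun i j => thresholds_halve hb hw) solution_zero hmono hfeas Finset.inter_subset_right
    (Finset.disjoint_left.2 fun o ho => (hmem o ho).2.1)
    (hO.subset J (Finset.union_subset Finset.inter_subset_left fun o ho => (hmem o ho).1))
    (fun o ho => (hmem o ho).2.2.2) ?_ ?_
  · have h1 : ∑ o ∈ O', θ (lev o) =
        ∑ o ∈ O \ A L, roundDown θ L (marginal f (A L) O o) := by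
      rw [hO', Finset.sum_filter]
      exact Finset.sum_congr rfl fun o _ => rfl
    rw [← h1]
    refine key.trans_eq ?_
    congr 1
    refine Finset.sum_congr rfl fun i hi => ?_
    have : (A (i + 1) \ A i) \ (O ∩ A L) = (A (i + 1) \ A i) \ O := by
      ext x
      have := @hmono (i + 1) L (Finset.mem_range.1 hi) x
      simp only [Finset.mem_sdiff, Finset.mem_inter]
      tauto
    rw [this]
  · intro o ho hJ
    have n1 := hnot o ho
    have m1 := marginal_le hf (O := O) (hmem o ho).2.1
      ((hmono (hmem o ho).2.2.2 : A (lev o + 1) ⊆ A L).trans Finset.subset_union_left)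
    have l1 := (hmem o ho).2.2.1
    rw [hsucc] at n1 hJ m1
    have := lt_of_insert_search hf (hfeas (lev o)) n1 hJ
    linarith
  · intro o ho o' ho' hne heq a ha ha'
    rcases lt_or_gt_of_ne hne with hlt | hlt
    · rw [Finset.insert_comm]
      exact hpair o ho o' ho' hlt heq a ha ha'
    · rw [heq] at ha ha' ⊢
      exact hpair o' ho' o ho hlt heq.symm a ha ha'

/-- The value of the solution for a monotone submodular function. -/
theorem sum_roundDown_le_of_submodular (hf : IsSubmodular f) (hmono : Monotone f) (hb : 2 ≤ b)
    (hw : 0 < w) (L : ℕ) {O : Finset (Fin n)} (hO : J.Feasible O) {δ : ℝ} (hδ : 0 < δ)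
    (hδ1 : δ ≤ 1) :
    ∑ o ∈ O, roundDown (fun i => w / b ^ i) L ((1 - δ) * marginal f ∅ O o) ≤
      ((k + 1) / 2 + 1 / δ) * (f (solution J.Feasible f b w L) - f ∅) := by
  classical
  set A := solution J.Feasible f b w L with hA
  set θ : ℕ → ℝ := fun i => w / b ^ i with hθ
  have hθ0 : ∀ i, 0 ≤ θ i := fun i => (thresholds_pos hb hw i).le
  have hanti : Antitone θ := thresholds_antitone hb hw
  have hm0 : ∀ o, 0 ≤ marginal f A O o := fun o =>
    sub_nonneg.2 (hmono (Finset.subset_insert _ _))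
  have hmw : ∀ o ∈ O, marginal f A O o ≤ marginal f ∅ O o := by
    intro o ho
    by_cases hoA : o ∈ A
    · rw [marginal, Finset.insert_eq_of_mem (Finset.mem_union_left _ hoA), sub_self]
      exact sub_nonneg.2 (hmono (Finset.subset_insert _ _))
    · rw [marginal, marginal, Finset.empty_union]
      exact hf _ _ Finset.subset_union_right o (by simp [hoA])
  -- If `o ∉ A` keeps the fraction `1 - δ` of its marginal value, roundings are compared by
  -- monotonicity. Otherwise its loss is at least `δ` times that value, so the loss divided by `δ`
  -- pays for it; an element of `A` loses everything.
  have hterm : ∀ o ∈ O, roundDown θ L ((1 - δ) * marginal f ∅ O o) ≤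
      (if o ∈ A then 0 else roundDown θ L (marginal f A O o)) +
        (marginal f ∅ O o - marginal f A O o) / δ := by
    intro o ho
    have h1 := hmw o ho
    have h2 := hm0 o
    by_cases hle : ¬ o ∈ A ∧ (1 - δ) * marginal f ∅ O o ≤ marginal f A O o
    · rw [if_neg hle.1]
      have h3 := roundDown_mono (L := L) hanti hθ0 hle.2
      have h4 : 0 ≤ (marginal f ∅ O o - marginal f A O o) / δ := div_nonneg (by linarith) hδ.le
      linarith
    · have h3 : roundDown θ L ((1 - δ) * marginal f ∅ O o) ≤ (1 - δ) * marginal f ∅ O o :=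
        roundDown_le (mul_nonneg (by linarith) (h2.trans h1))
      have h4 : δ * marginal f ∅ O o ≤ marginal f ∅ O o - marginal f A O o := by
        by_cases hoA : o ∈ A
        · have : marginal f A O o = 0 := by
            rw [marginal, Finset.insert_eq_of_mem (Finset.mem_union_left _ hoA), sub_self]
          rw [this]
          nlinarith
        · have := not_le.1 fun h => hle ⟨hoA, h⟩
          linarith
      have h5 : marginal f ∅ O o ≤ (marginal f ∅ O o - marginal f A O o) / δ := by
        rw [le_div_iff₀ hδ]
        linarith
      have h6 : 0 ≤ (if o ∈ A then 0 else roundDown θ L (marginal f A O o)) := by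
        split_ifs
        exacts [le_rfl, roundDown_nonneg hθ0]
      nlinarith
  have hsum := Finset.sum_le_sum hterm
  rw [Finset.sum_add_distrib, ← Finset.sum_div, Finset.sum_sub_distrib, sum_marginal,
    sum_marginal, Finset.empty_union] at hsum
  have h1 : (∑ o ∈ O, if o ∈ A then 0 else roundDown θ L (marginal f A O o)) =
      ∑ o ∈ O \ A, roundDown θ L (marginal f A O o) := by
    rw [← Finset.filter_notMem_eq_sdiff, Finset.sum_filter]
    exact Finset.sum_congr rfl fun o _ => by simp
  have h2 := sum_roundDown_marginal_le hf hb hw L hO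
  have h3 := solution_value (b := b) (w := w) hf J.feasible_empty L
  have h4 : ∑ i ∈ Finset.range L, w / b ^ i *
      (((solution J.Feasible f b w (i + 1) \ solution J.Feasible f b w i) \ O).card : ℝ) ≤
      f A - f ∅ := by
    refine le_trans (Finset.sum_le_sum fun i _ => ?_) (le_sub_iff_add_le'.2 h3)
    refine mul_le_mul_of_nonneg_left ?_ (hθ0 i)
    exact_mod_cast Finset.card_le_card Finset.sdiff_subset
  -- The marginal values telescope, and monotonicity bounds their total loss by the value of the
  -- solution.
  have h5 : (f O - f ∅ - (f (A ∪ O) - f A)) / δ ≤ (f A - f ∅) / δ := by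
    refine div_le_div_of_nonneg_right ?_ hδ.le
    have := hmono (Finset.subset_union_right : O ⊆ A ∪ O)
    linarith
  have h6 : ((k : ℝ) + 1) / 2 * _ ≤ ((k : ℝ) + 1) / 2 * (f A - f ∅) :=
    mul_le_mul_of_nonneg_left h4 (by positivity)
  rw [h1] at hsum
  calc _ ≤ _ := hsum
    _ ≤ (k + 1) / 2 * (f A - f ∅) + (f A - f ∅) / δ := add_le_add (h2.trans h6) h5
    _ = _ := by ring

/-- The value of the solution for a linear function. -/
theorem sum_roundDown_le_of_linear {c : Fin n → ℝ} (hc : ∀ S, f S = ∑ e ∈ S, c e)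
    (hk : 1 ≤ k) (hb : 2 ≤ b) (hw : 0 < w) (L : ℕ) {O : Finset (Fin n)} (hO : J.Feasible O) :
    ∑ o ∈ O, roundDown (fun i => w / b ^ i) L (c o) ≤
      (k + 1) / 2 * f (solution J.Feasible f b w L) := by
  classical
  have hins : ∀ (S : Finset (Fin n)) (e : Fin n), e ∉ S → f (insert e S) - f S = c e := by
    intro S e he
    rw [hc, hc, Finset.sum_insert he]
    ring
  have hf : IsSubmodular f := fun S T hST e he => by
    rw [hins T e he, hins S e fun h => he (hST h)]
  have hf0 : f ∅ = 0 := by simp [hc]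
  set A := solution J.Feasible f b w with hA
  set θ : ℕ → ℝ := fun i => w / b ^ i with hθ
  have hθ0 : ∀ i, 0 ≤ θ i := fun i => (thresholds_pos hb hw i).le
  have hanti : Antitone θ := thresholds_antitone hb hw
  have h0 := J.feasible_empty
  have hmono : Monotone A := solution_mono hf h0
  have hfeas : ∀ i, J.Feasible (A i) := solution_feasible hf h0
  have hsucc : ∀ i, A (i + 1) = (search J.Feasible f (θ i) (A i)).1 := fun i => solution_succ i
  have h1 := sum_roundDown_marginal_le hf hb hw L hO
  have h2 : ∑ o ∈ O \ A L, roundDown θ L (marginal f (A L) O o) =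
      ∑ o ∈ O \ A L, roundDown θ L (c o) := by
    refine Finset.sum_congr rfl fun o ho => ?_
    rw [marginal, hins]
    simp [(Finset.mem_sdiff.1 ho).2]
  have h3 : ∑ o ∈ O ∩ A L, roundDown θ L (c o) ≤
      ∑ i ∈ Finset.range L, θ i * ((A (i + 1) \ A i) ∩ O).card := by
    -- If `o` enters at level `i`, then its rounded weight is at most `θ i`: at each earlier level
    -- it could still have been added feasibly, so its weight was below that threshold.
    have hlow : ∀ o ∈ O ∩ A L, roundDown θ L (c o) ≤
        ∑ i ∈ Finset.range L, if o ∈ (A (i + 1) \ A i) ∩ O then θ i else 0 := by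
      intro o ho
      rw [Finset.mem_inter] at ho
      have hex : ∃ i < L, o ∉ A i ∧ o ∈ A (i + 1) := by
        by_contra! hcon
        have : ∀ i ≤ L, o ∉ A i := by
          intro i
          induction i with
          | zero => simp [hA, solution_zero]
          | succ i ih => exact fun hi => hcon i (by omega) (ih (by omega))
        exact this L le_rfl ho.2
      obtain ⟨i, hi, hoi, hoi'⟩ := hex
      refine le_trans ?_ (Finset.single_le_sum
        (f := fun i => if o ∈ (A (i + 1) \ A i) ∩ O then θ i else 0) (fun i _ => by
          split_ifs
          exacts [hθ0 i, le_rfl]) (Finset.mem_range.2 hi))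
      rw [if_pos (by simp [hoi, hoi', ho.1])]
      refine roundDown_le_of_lt hanti hθ0 fun j hj => ?_
      have hoj : o ∉ A (j + 1) := fun h => hoi (hmono hj h)
      have hJ : J.Feasible (insert o (A (j + 1))) :=
        (hfeas L).subset J (Finset.insert_subset ho.2 (hmono (by omega)))
      rw [← hins _ _ hoj]
      rw [hsucc] at hoj hJ ⊢
      exact lt_of_insert_search hf (hfeas j) hoj hJ
    refine (Finset.sum_le_sum hlow).trans ?_
    rw [Finset.sum_comm]
    refine Finset.sum_le_sum fun i _ => ?_
    rw [← Finset.sum_filter, Finset.sum_const, nsmul_eq_mul, mul_comm]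
    refine mul_le_mul_of_nonneg_left ?_ (hθ0 i)
    exact_mod_cast Finset.card_le_card fun x hx => (Finset.mem_filter.1 hx).2
  have h4 := solution_value (b := b) (w := w) hf h0 L
  rw [hf0, zero_add] at h4
  have h5 : ∀ i, ((A (i + 1) \ A i).card : ℝ) =
      ((A (i + 1) \ A i) \ O).card + ((A (i + 1) \ A i) ∩ O).card := by
    intro i
    exact_mod_cast (Finset.card_sdiff_add_card_inter _ _).symm
  have h6 : ∑ i ∈ Finset.range L, θ i * ((A (i + 1) \ A i) \ O).card +
      ∑ i ∈ Finset.range L, θ i * ((A (i + 1) \ A i) ∩ O).card ≤ f (A L) := by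
    rw [← Finset.sum_add_distrib]
    refine le_trans (Finset.sum_le_sum fun i _ => ?_) h4
    rw [← mul_add, ← h5]
  have h7 : 0 ≤ ∑ i ∈ Finset.range L, θ i * (((A (i + 1) \ A i) ∩ O).card : ℝ) :=
    Finset.sum_nonneg fun i _ => mul_nonneg (hθ0 i) (Nat.cast_nonneg _)
  -- Common elements are matched with factor `1`, which is no worse than `(k + 1) / 2` because `k ≥
  -- 1`.
  have hk' : (1 : ℝ) ≤ (k + 1) / 2 := by
    have : (1 : ℝ) ≤ k := by exact_mod_cast hk
    linarith
  have h8 : ∑ o ∈ O, roundDown θ L (c o) =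
      ∑ o ∈ O \ A L, roundDown θ L (c o) + ∑ o ∈ O ∩ A L, roundDown θ L (c o) := by
    rw [← Finset.sum_union (Finset.disjoint_sdiff_inter O (A L)), Finset.sdiff_union_inter]
  rw [h8, ← h2]
  refine (add_le_add h1 h3).trans ?_
  nlinarith

end Run

end RealRAM

namespace RealRAM

/-! ### Averaging over the initial thresholds -/

section Averaging

variable {n : ℕ} {ε : ℝ} {N M : ℕ}

namespace Parameters

theorem M_pos (h : Parameters n ε N M) : 0 < M := by
  by_contra! hM
  have := h.two_le
  rw [Nat.le_zero.1 hM, pow_zero] at this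
  linarith

/-- The number of initial thresholds is about `N ln 2`. -/
theorem M_div_le (h : Parameters n ε N M) : (M : ℝ) / N ≤ Real.log 2 + 2 / N := by
  have hN := h.pos
  have hM := h.M_pos
  have hy : (0 : ℝ) < 1 + 1 / N := by positivity
  have h1 := h.lt_two (M - 1) (by omega)
  have h2 := Real.log_lt_log (by positivity) h1
  rw [Real.log_pow, Nat.cast_sub hM, Nat.cast_one] at h2
  -- With `log (1 + 1 / N) ≥ 1 / (N + 1)`, minimality of `M` gives `M - 1 ≤ (N + 1) ln 2`, and `ln 2
  -- + 1 ≤ 2` absorbs the rest.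
  have h3 := Real.one_sub_inv_le_log_of_pos hy
  have h4 : 1 - (1 + 1 / (N : ℝ))⁻¹ = 1 / (N + 1) := by
    field_simp
    ring
  rw [h4] at h3
  have h5 : ((M : ℝ) - 1) * (1 / (N + 1)) ≤ Real.log 2 :=
    (mul_le_mul_of_nonneg_left h3 (by
      have : (1 : ℝ) ≤ M := by exact_mod_cast hM
      linarith)).trans h2.le
  have h6 : Real.log 2 ≤ 1 := Real.log_two_lt_d9.le.trans (by norm_num)
  rw [mul_one_div, div_le_iff₀ (by positivity)] at h5
  rw [div_le_iff₀ hN, add_mul, div_mul_cancel₀ _ hN.ne']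
  nlinarith

/-- Rounding down to a random one of the progressions costs a factor of about `2 ln 2`. -/
theorem mul_le_sum_roundDown (h : Parameters n ε N M) {W v : ℝ} (hv : 0 ≤ v)
    (hvW : v ≤ W) :
    M * v ≤ (2 * Real.log 2 + 4 / N) * ∑ j ∈ Finset.range M,
      roundDown (fun i => W / (1 + 1 / N) ^ j / ((1 + 1 / N) ^ M) ^ i) (N + 1) v + M * W / N := by
  have hN := h.pos
  have hM := h.M_pos
  have hlog : 0 < Real.log 2 := Real.log_pos one_lt_two
  rcases hv.eq_or_lt with rfl | hv
  · have : 0 ≤ ∑ j ∈ Finset.range M,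
      roundDown (fun i => W / (1 + 1 / N) ^ j / ((1 + 1 / N) ^ M) ^ i) (N + 1) (0 : ℝ) :=
      Finset.sum_nonneg fun j _ => roundDown_nonneg fun i => by positivity
    rw [mul_zero]
    positivity
  have hW : 0 < W := hv.trans_le hvW
  set y : ℝ := 1 + 1 / N with hy
  have hy1 : 1 < y := by
    rw [hy]
    linarith [one_div_pos.2 hN]
  have hy0 : 0 < y := by linarith
  have hb := h.two_le
  have hsum0 : 0 ≤ ∑ j ∈ Finset.range M, roundDown (fun i => W / y ^ j / (y ^ M) ^ i) (N + 1) v :=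
    Finset.sum_nonneg fun j _ => roundDown_nonneg fun i => by positivity
  -- Values below the last threshold may be rounded to zero; as `(y ^ M) ^ N ≥ 2 ^ N ≥ N`, they are
  -- covered by the error term `M * W / N`.
  by_cases hsmall : v < W / (y ^ M) ^ N
  · have h1 : W / (y ^ M) ^ N ≤ W / N := by
      refine div_le_div_of_nonneg_left hW.le hN ?_
      have h2 : (N : ℝ) ≤ 2 ^ N := by exact_mod_cast Nat.lt_two_pow_self.le
      exact h2.trans (pow_le_pow_left₀ zero_le_two hb N)
    have h2 : (M : ℝ) * v ≤ M * W / N := by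
      rw [mul_div_assoc]
      exact mul_le_mul_of_nonneg_left (hsmall.le.trans h1) (Nat.cast_nonneg M)
    have h3 : 0 ≤ (2 * Real.log 2 + 4 / N) * ∑ j ∈ Finset.range M,
      roundDown (fun i => W / y ^ j / (y ^ M) ^ i) (N + 1) v := mul_nonneg (by positivity) hsum0
    linarith
  · have hex : ∃ l : ℕ, W / y ^ l ≤ v := ⟨M * N, by
      rw [pow_mul]
      exact not_lt.1 hsmall⟩
    classical
    -- All progressions together form the single progression `W / y ^ l` with `l = j + M * i`.
    -- Starting from the first `l₀` whose threshold is at most `v`, a window of `M` consecutive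
    -- exponents meets each residue `j` once.
    set l₀ := Nat.find hex with hl₀
    have hl₀v : W / y ^ l₀ ≤ v := Nat.find_spec hex
    have hl₀le : l₀ ≤ M * N := Nat.find_min' hex (by
      rw [pow_mul]
      exact not_lt.1 hsmall)
    have hlow : v / y ≤ W / y ^ l₀ := by
      rcases Nat.eq_zero_or_pos l₀ with h0 | h0
      · rw [h0, pow_zero, div_one]
        exact (div_le_self hv.le hy1.le).trans hvW
      · have h1 : v < W / y ^ (l₀ - 1) := not_le.1 (Nat.find_min hex (by omega))
        have h2 : y ^ l₀ = y ^ (l₀ - 1) * y := by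
          rw [← pow_succ, Nat.sub_add_cancel h0]
        rw [h2, ← div_div]
        exact div_le_div_of_nonneg_right h1.le hy0.le
    have hround : ∀ l ∈ Finset.Ico l₀ (l₀ + M), W / y ^ l ≤
        roundDown (fun i => W / y ^ (l % M) / (y ^ M) ^ i) (N + 1) v := by
      intro l hl
      rw [Finset.mem_Ico] at hl
      have heq : W / y ^ l = W / y ^ (l % M) / (y ^ M) ^ (l / M) := by
        rw [div_div, ← pow_mul, ← pow_add, Nat.mod_add_div]
      rw [heq]
      refine le_roundDown (θ := fun i => W / y ^ (l % M) / (y ^ M) ^ i)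
        (thresholds_antitone hb (by positivity)) ?_ ?_
      -- The window may reach beyond exponent `M * N`, which is why `N + 1` thresholds per
      -- progression are used.
      · rw [Nat.div_lt_iff_lt_mul hM]
        nlinarith
      · rw [← heq]
        refine le_trans (div_le_div_of_nonneg_left hW.le (by positivity) ?_) hl₀v
        exact pow_le_pow_right₀ hy1.le hl.1
    have hsum : ∑ l ∈ Finset.Ico l₀ (l₀ + M), W / y ^ l ≤ ∑ j ∈ Finset.range M,
        roundDown (fun i => W / y ^ j / (y ^ M) ^ i) (N + 1) v := by
      refine (Finset.sum_le_sum hround).trans_eq ?_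
      rw [← Nat.image_Ico_mod l₀ M, Finset.sum_image]
      exact fun x hx x' hx' => Nat.mod_injOn_Ico l₀ M hx hx'
    -- The discrete form of the integral of `2 ^ (-u)` over the unit interval. The window starts at
    -- `v / y` or above and its ratio is `y⁻¹` with `1 - y⁻¹ = 1 / (N + 1)`; the `M` terms add up to
    -- at least half of the infinite series, since `y ^ M ≥ 2`.
    have hgeom : v / 2 * N ≤ ∑ l ∈ Finset.Ico l₀ (l₀ + M), W / y ^ l := by
      rw [Finset.sum_Ico_eq_sum_range, Nat.add_sub_cancel_left]
      have h1 : ∀ i, W / y ^ (l₀ + i) = W / y ^ l₀ * (y⁻¹) ^ i := by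
        intro i
        rw [pow_add, ← div_div, inv_pow, div_eq_mul_inv (W / y ^ l₀)]
      simp only [h1]
      rw [← Finset.mul_sum]
      have h2 := mul_neg_geom_sum (y⁻¹) M
      have h3 : 1 - y⁻¹ = 1 / (N + 1) := by
        rw [hy]
        field_simp
        ring
      rw [h3] at h2
      have h4 : (1 : ℝ) / 2 ≤ 1 - y⁻¹ ^ M := by
        have : y⁻¹ ^ M ≤ 1 / 2 := by
          rw [inv_pow, ← one_div]
          exact one_div_le_one_div_of_le zero_lt_two hb
        linarith
      rw [← h2, one_div_mul_eq_div, le_div_iff₀ (by positivity)] at h4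
      have h5 : v / y = v * N / (N + 1) := by
        rw [hy]
        field_simp
      rw [h5] at hlow
      calc v / 2 * N = v * N / (N + 1) * (1 / 2 * (N + 1)) := by
            field_simp
        _ ≤ W / y ^ l₀ * ∑ i ∈ Finset.range M, y⁻¹ ^ i :=
            mul_le_mul hlow h4 (by positivity) (by positivity)
    have hMN := h.M_div_le
    rw [div_le_iff₀ hN] at hMN
    have hfin : (M : ℝ) * v ≤ (2 * Real.log 2 + 4 / N) * (v / 2 * N) := by
      have := mul_le_mul_of_nonneg_right hMN hv.le
      calc (M : ℝ) * v ≤ _ := this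
        _ = _ := by ring
    have : (0 : ℝ) ≤ M * W / N := by positivity
    have h6 := mul_le_mul_of_nonneg_left (hgeom.trans hsum)
      (show (0 : ℝ) ≤ 2 * Real.log 2 + 4 / N by positivity)
    linarith

end Parameters

end Averaging

/-! ### The best solution -/

section BestSet

variable {n : ℕ} {I : Finset (Fin n) → Prop} {f : Finset (Fin n) → ℝ} {L M : ℕ} {y b : ℝ}

theorem iterate_improve_fst (w : ℝ) (B : Finset (Fin n)) (m : ℕ) :
    (iterate (fun _ => improve I f L y b) m (w, B)).1 = w / y ^ m := by
  induction m with
  | zero => simp [iterate]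
  | succ m ih =>
    have : (iterate (fun _ => improve I f L y b) (m + 1) (w, B)).1 =
      (iterate (fun _ => improve I f L y b) m (w, B)).1 / y := rfl
    rw [this, ih, pow_succ, div_div]

theorem improve_value (X : ℝ × Finset (Fin n)) :
    f X.2 ≤ f (improve I f L y b X).2 ∧
      f (solution I f b X.1 L) ≤ f (improve I f L y b X).2 := by
  simp only [improve, solution]
  split_ifs with h
  · exact ⟨h, le_rfl⟩
  · exact ⟨le_rfl, (not_le.1 h).le⟩

theorem iterate_improve_value (w : ℝ) (B : Finset (Fin n)) (m : ℕ) :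
    f B ≤ f (iterate (fun _ => improve I f L y b) m (w, B)).2 ∧
      ∀ j < m, f (solution I f b (w / y ^ j) L) ≤
        f (iterate (fun _ => improve I f L y b) m (w, B)).2 := by
  induction m with
  | zero => exact ⟨le_rfl, fun j hj => absurd hj (Nat.not_lt_zero j)⟩
  | succ m ih =>
    have h := improve_value (I := I) (f := f) (L := L) (y := y) (b := b)
      (iterate (fun _ => improve I f L y b) m (w, B))
    refine ⟨ih.1.trans h.1, fun j hj => ?_⟩
    rcases Nat.lt_succ_iff_lt_or_eq.1 hj with hj | rfl
    · exact (ih.2 j hj).trans h.1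
    · rw [iterate_improve_fst] at h
      exact h.2

/-- The current best set is only replaced by one of at least the same value. -/
theorem bestSet_value :
    f ∅ ≤ f (bestSet I f L M y b) ∧ ∀ (e : Fin n), ∀ j < M,
      f (solution I f b ((f {e} - f ∅) / y ^ j) L) ≤ f (bestSet I f L M y b) := by
  have key : ∀ m, f ∅ ≤ f (iterate (fun e B =>
      (iterate (fun _ => improve I f L y b) M (f (put ∅ e) - f ∅, B)).2) m ∅) ∧
      ∀ e : Fin n, (e : ℕ) < m → ∀ j < M, f (solution I f b ((f {e} - f ∅) / y ^ j) L) ≤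
        f (iterate (fun e B =>
          (iterate (fun _ => improve I f L y b) M (f (put ∅ e) - f ∅, B)).2) m ∅) := by
    intro m
    induction m with
    | zero => exact ⟨le_rfl, fun e he => absurd he (Nat.not_lt_zero _)⟩
    | succ m ih =>
      have h := fun w B => iterate_improve_value (I := I) (f := f) (L := L) (y := y) (b := b) w B M
      simp only [iterate] at ih ⊢
      refine ⟨ih.1.trans (h _ _).1, fun e he j hj => ?_⟩
      rcases Nat.lt_succ_iff_lt_or_eq.1 he with he | rfl
      · exact (ih.2 e he j hj).trans (h _ _).1
      · have := (h (f (put ∅ e) - f ∅) (iterate (fun e B =>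
          (iterate (fun _ => improve I f L y b) M (f (put ∅ e) - f ∅, B)).2) e ∅)).2 j hj
        rw [put_eq_insert, insert_empty_eq] at this ⊢
        exact this
  exact ⟨(key n).1, fun e => (key n).2 e e.2⟩

/-- No sign of the initial threshold is needed: elements of negative marginal value produce useless,
but feasible, candidates. -/
theorem bestSet_feasible (hf : IsSubmodular f) (h0 : I ∅) : I (bestSet I f L M y b) := by
  refine iterate_induction (fun e _ B hB => ?_) h0
  refine iterate_induction (P := fun X : ℝ × Finset (Fin n) => I X.2) (fun _ _ X hX => ?_) hB
  simp only [improve]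
  split_ifs
  · exact solution_feasible hf h0 L
  · exact hX

end BestSet

end RealRAM

namespace RealRAM

/-! ### Approximation ratios of the best solution -/

section Ratio

variable {n k : ℕ} {V : Type*} {J : MatroidParity k (Fin n) V} {f : Finset (Fin n) → ℝ} {ε : ℝ}
  {N M : ℕ}

/-- The set computed by the program. -/
noncomputable def output (I : Finset (Fin n) → Prop) (f : Finset (Fin n) → ℝ) (N M : ℕ) :
    Finset (Fin n) :=
  bestSet I f (N + 1) M (1 + 1 / N) ((1 + 1 / N) ^ M)

/-- Averaging the bounds for the solutions with the different initial thresholds. -/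
theorem Parameters.sum_le_of_roundDown_le (h : Parameters n ε N M) {W F κ : ℝ} {O : Finset (Fin n)}
    {v : Fin n → ℝ} (hv : ∀ o ∈ O, 0 ≤ v o) (hvW : ∀ o ∈ O, v o ≤ W) (hW : 0 ≤ W) (hWF : W ≤ F)
    (hround : ∀ j < M, ∑ o ∈ O,
      roundDown (fun i => W / (1 + 1 / N) ^ j / ((1 + 1 / N) ^ M) ^ i) (N + 1) (v o) ≤ κ * F) :
    ∑ o ∈ O, v o ≤ ((2 * Real.log 2 + 4 / N) * κ + n / N) * F := by
  have hN := h.pos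
  have hM : (0 : ℝ) < M := by exact_mod_cast h.M_pos
  have hlog : 0 < Real.log 2 := Real.log_pos one_lt_two
  have h1 := Finset.sum_le_sum fun o ho => h.mul_le_sum_roundDown (hv o ho) (hvW o ho)
  rw [← Finset.mul_sum, Finset.sum_add_distrib, ← Finset.mul_sum, Finset.sum_comm,
    Finset.sum_const, nsmul_eq_mul] at h1
  have h2 := Finset.sum_le_sum fun j hj => hround j (Finset.mem_range.1 hj)
  rw [Finset.sum_const, Finset.card_range, nsmul_eq_mul] at h2
  have h3 := mul_le_mul_of_nonneg_left h2 (show (0 : ℝ) ≤ 2 * Real.log 2 + 4 / N by positivity)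
  have h4 : (O.card : ℝ) * (M * W / N) ≤ n * (M * F / N) := by
    have : O.card ≤ n := by simpa using O.card_le_univ
    have h5 : (O.card : ℝ) ≤ n := by exact_mod_cast this
    refine mul_le_mul h5 ?_ (by positivity) (Nat.cast_nonneg n)
    exact div_le_div_of_nonneg_right (mul_le_mul_of_nonneg_left hWF hM.le) hN.le
  refine le_of_mul_le_mul_left ?_ hM
  calc (M : ℝ) * ∑ o ∈ O, v o ≤ _ := h1.trans (add_le_add h3 h4)
    _ = _ := by ring

/-- The analysis uses only the scale given by the best feasible single element. The algorithm tries
all elements, so it need not know which one this is. -/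
theorem exists_max_singleton (J : MatroidParity k (Fin n) V) (g : Fin n → ℝ) {O : Finset (Fin n)}
    (hO : J.Feasible O) (hne : O.Nonempty) :
    ∃ e, J.Feasible {e} ∧ ∀ o, J.Feasible {o} → g o ≤ g e := by
  classical
  obtain ⟨o, ho⟩ := hne
  obtain ⟨e, he, hmax⟩ := Finset.exists_max_image (Finset.univ.filter fun e => J.Feasible {e}) g
    ⟨o, by simpa using hO.subset J (Finset.singleton_subset_iff.2 ho)⟩
  exact ⟨e, (Finset.mem_filter.1 he).2, fun o ho => hmax o (by simpa using ho)⟩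

theorem linear_le_output (hP : Parameters n ε N M) (hk : 1 ≤ k) (hf : IsLinearSetFunction f)
    {O : Finset (Fin n)} (hO : J.Feasible O) :
    f O ≤ ((k + 1) * Real.log 2 + 50 * ε) * f (output J.Feasible f N M) := by
  classical
  obtain ⟨c, hc⟩ := hf
  have hins : ∀ (S : Finset (Fin n)) (e : Fin n), e ∉ S → f (insert e S) - f S = c e := by
    intro S e he
    rw [hc, hc, Finset.sum_insert he]
    ring
  have hsub : IsSubmodular f := fun S T hST e he => by
    rw [hins T e he, hins S e fun h => he (hST h)]
  have hf0 : f ∅ = 0 := by simp [hc]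
  have hf1 : ∀ e, f {e} = c e := fun e => by simp [hc]
  have hN := hP.pos
  have hlog : 1 / 2 < Real.log 2 := lt_trans (by norm_num) Real.log_two_gt_d9
  obtain ⟨hF0, hF⟩ := bestSet_value (I := J.Feasible) (f := f) (L := N + 1) (M := M)
    (y := 1 + 1 / N) (b := (1 + 1 / N) ^ M)
  change _ ≤ _ * f (bestSet _ _ _ _ _ _)
  set F := f (bestSet J.Feasible f (N + 1) M (1 + 1 / N) ((1 + 1 / N) ^ M))
  rw [hf0] at hF0
  have hnN : (n : ℝ) / N ≤ ε := by
    rw [div_le_iff₀ hN, mul_comm]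
    exact hP.le_mul
  have hε : 0 ≤ ε := le_trans (by positivity) hnN
  -- Discarding elements of nonpositive weight keeps feasibility and does not decrease the value;
  -- the averaging requires nonnegative values.
  set O' := O.filter fun o => 0 < c o with hO'
  have hOO' : f O ≤ f O' := by
    rw [hc, hc, hO', Finset.sum_filter]
    refine Finset.sum_le_sum fun o _ => ?_
    split_ifs with h
    exacts [le_rfl, not_lt.1 h]
  have hO'f : J.Feasible O' := hO.subset J (Finset.filter_subset _ _)
  refine hOO'.trans ?_
  rcases O'.eq_empty_or_nonempty with hemp | hne
  · rw [hemp, hf0]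
    positivity
  obtain ⟨e, he, hmax⟩ := exists_max_singleton J c hO'f hne
  have hcO : ∀ o ∈ O', 0 < c o ∧ c o ≤ c e := fun o ho =>
    ⟨(Finset.mem_filter.1 ho).2, hmax o (hO'f.subset J (Finset.singleton_subset_iff.2 ho))⟩
  have hW : 0 < c e := by
    obtain ⟨o, ho⟩ := hne
    exact (hcO o ho).1.trans_le (hcO o ho).2
  have hF' : ∀ j < M, f (solution J.Feasible f ((1 + 1 / N) ^ M) (c e / (1 + 1 / N) ^ j) (N + 1)) ≤
      F := by
    intro j hj
    have := hF e j hj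
    rwa [hf0, sub_zero, hf1] at this
  have hWF : c e ≤ F := by
    have h1 := hF' 0 hP.M_pos
    rw [pow_zero, div_one] at h1
    have h2 := le_solution_of_singleton (L := N + 1) hsub J.feasible_empty
      (zero_lt_two.trans_le hP.two_le) hW.le he (by rw [hf0, hf1, sub_zero]) (Nat.succ_pos N)
    rw [hf0, zero_add] at h2
    exact h2.trans h1
  -- The error term `4 / N` is multiplied by `(k + 1) / 2`, so `k` must be bounded by the input
  -- size. For larger `k` the best single element suffices: it gives ratio `n < (k + 1) / 2 ≤ (k +
  -- 1) ln 2`.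
  by_cases hkn : (2 * n : ℝ) < k + 1
  · have h1 : f O' ≤ n * F := by
      rw [hc]
      refine (Finset.sum_le_card_nsmul O' c F fun o ho => (hcO o ho).2.trans hWF).trans ?_
      rw [nsmul_eq_mul]
      refine mul_le_mul_of_nonneg_right ?_ hF0
      have : O'.card ≤ n := by simpa using O'.card_le_univ
      exact_mod_cast this
    refine h1.trans (mul_le_mul_of_nonneg_right ?_ hF0)
    nlinarith
  · have h1 := hP.sum_le_of_roundDown_le (F := F) (κ := (k + 1) / 2) (v := c)
      (fun o ho => (hcO o ho).1.le) (fun o ho => (hcO o ho).2) hW.le hWF fun j hj =>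
        (sum_roundDown_le_of_linear hc hk hP.two_le (by positivity) (N + 1) hO'f).trans
          (mul_le_mul_of_nonneg_left (hF' j hj) (by positivity))
    rw [← hc] at h1
    refine h1.trans (mul_le_mul_of_nonneg_right ?_ hF0)
    have h2 : 4 / (N : ℝ) * ((k + 1) / 2) ≤ 4 * (n / N) := by
      rw [show 4 / (N : ℝ) * ((k + 1) / 2) = 2 * (k + 1) / N by ring, mul_div_assoc']
      refine div_le_div_of_nonneg_right ?_ hN.le
      linarith
    linarith

theorem submodular_le_output (hP : Parameters n ε N M) (hk : 1 ≤ k) (hpos : ∀ S, 0 ≤ f S)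
    (hmono : Monotone f) (hf : IsSubmodular f) {O : Finset (Fin n)} (hO : J.Feasible O) :
    f O ≤ (k * Real.log 2 + 50 * Real.sqrt k) * f (output J.Feasible f N M) := by
  classical
  have hN := hP.pos
  have hlog : 0 < Real.log 2 := Real.log_pos one_lt_two
  have hlog1 : Real.log 2 ≤ 1 := Real.log_two_lt_d9.le.trans (by norm_num)
  obtain ⟨hF0, hF⟩ := bestSet_value (I := J.Feasible) (f := f) (L := N + 1) (M := M)
    (y := 1 + 1 / N) (b := (1 + 1 / N) ^ M)
  change _ ≤ _ * f (bestSet _ _ _ _ _ _)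
  set F := f (bestSet J.Feasible f (N + 1) M (1 + 1 / N) ((1 + 1 / N) ^ M))
  set s := Real.sqrt k with hs
  have hks : (k : ℝ) = s ^ 2 := (Real.sq_sqrt (Nat.cast_nonneg k)).symm
  have hs1 : 1 ≤ s := by
    rw [hs, Real.one_le_sqrt]
    exact_mod_cast hk
  have hR : 1 ≤ k * Real.log 2 + 50 * s := by
    have : 0 ≤ k * Real.log 2 := by positivity
    linarith
  -- The value `f ∅` may be restored on both sides because it is nonnegative and the ratio is at
  -- least `1`.
  suffices h : f O - f ∅ ≤ (k * Real.log 2 + 50 * s) * (F - f ∅) by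
    nlinarith [hpos ∅]
  have hG : 0 ≤ F - f ∅ := sub_nonneg.2 hF0
  have hsum := sum_marginal f ∅ O
  rw [Finset.empty_union] at hsum
  have hm0 : ∀ o, 0 ≤ marginal f ∅ O o := fun o =>
    sub_nonneg.2 (hmono (Finset.subset_insert _ _))
  have hm1 : ∀ o, marginal f ∅ O o ≤ f {o} - f ∅ := fun o => by
    have := marginal_le hf (O := O) (Finset.notMem_empty o) (Finset.empty_subset _)
    rwa [insert_empty_eq] at this
  rcases O.eq_empty_or_nonempty with hemp | hne
  · rw [hemp, sub_self]
    exact mul_nonneg (by linarith) hG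
  obtain ⟨e, he, hmax⟩ := exists_max_singleton J (fun e => f {e} - f ∅) hO hne
  set W := f {e} - f ∅ with hW
  have hW0 : 0 ≤ W := sub_nonneg.2 (hmono (Finset.empty_subset _))
  have hmW : ∀ o ∈ O, marginal f ∅ O o ≤ W := fun o ho =>
    (hm1 o).trans (hmax o (hO.subset J (Finset.singleton_subset_iff.2 ho)))
  rcases hW0.eq_or_lt with hWz | hWpos
  · have h1 : ∑ o ∈ O, marginal f ∅ O o ≤ 0 :=
      Finset.sum_nonpos fun o ho => (hmW o ho).trans hWz.ge
    rw [← hsum]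
    exact h1.trans (mul_nonneg (by linarith) hG)
  have hF' : ∀ j < M, f (solution J.Feasible f ((1 + 1 / N) ^ M) (W / (1 + 1 / N) ^ j) (N + 1)) ≤
      F := hF e
  have hWF : W ≤ F - f ∅ := by
    have h1 := hF' 0 hP.M_pos
    rw [pow_zero, div_one] at h1
    have h2 := le_solution_of_singleton (L := N + 1) hf J.feasible_empty
      (zero_lt_two.trans_le hP.two_le) hW0 he le_rfl (Nat.succ_pos N)
    linarith
  have hnN : (n : ℝ) ≤ N := by exact_mod_cast hP.lt.le
  -- If `N < √k`, then `n < √k` and a single element is good enough. Otherwise `4 / N ≤ 4 / √k`, so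
  -- that the discretization error is of order `√k` whatever `ε` is.
  by_cases hsN : (N : ℝ) < s
  · have h1 : f O - f ∅ ≤ n * (F - f ∅) := by
      rw [← hsum]
      refine (Finset.sum_le_card_nsmul O _ (F - f ∅) fun o ho => (hmW o ho).trans hWF).trans ?_
      rw [nsmul_eq_mul]
      refine mul_le_mul_of_nonneg_right ?_ hG
      have : O.card ≤ n := by simpa using O.card_le_univ
      exact_mod_cast this
    refine h1.trans (mul_le_mul_of_nonneg_right ?_ hG)
    have : 0 ≤ k * Real.log 2 := by positivity
    linarith
  · have hs0 : 0 < s := by linarith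
    -- This balances the additive cost `1 / δ = 2√k` against the loss of the factor `1 - δ`, which
    -- on `k ln 2` is also of order `√k`.
    set δ := 1 / (2 * s) with hδ
    have hδ0 : 0 < δ := by positivity
    have hδ1 : δ ≤ 1 := by
      rw [hδ, div_le_one (by positivity)]
      linarith
    have h1 := hP.sum_le_of_roundDown_le (F := F - f ∅) (κ := (k + 1) / 2 + 1 / δ)
      (v := fun o => (1 - δ) * marginal f ∅ O o)
      (fun o _ => mul_nonneg (by linarith) (hm0 o))
      (fun o ho => (mul_le_of_le_one_left (hm0 o) (by linarith)).trans (hmW o ho)) hW0 hWF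
      fun j hj => (sum_roundDown_le_of_submodular hf hmono hP.two_le (by positivity) (N + 1) hO
        hδ0 hδ1).trans (mul_le_mul_of_nonneg_left (sub_le_sub_right (hF' j hj) _) (by positivity))
    rw [← Finset.mul_sum, hsum] at h1
    have h2 : 1 / δ = 2 * s := by
      rw [hδ, one_div_one_div]
    have h3 : 4 / (N : ℝ) ≤ 4 / s := div_le_div_of_nonneg_left (by norm_num) hs0 (not_lt.1 hsN)
    have h4 : (n : ℝ) / N ≤ 1 := by
      rw [div_le_one hN]
      exact hnN
    have h5 : 4 / (N : ℝ) * ((k + 1) / 2 + 2 * s) ≤ 12 * s := by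
      refine (mul_le_mul_of_nonneg_right h3 (by positivity)).trans ?_
      rw [div_mul_eq_mul_div, div_le_iff₀ hs0, hks]
      nlinarith
    have h6 : (2 * Real.log 2 + 4 / N) * ((k + 1) / 2 + 1 / δ) + n / N ≤
        k * Real.log 2 + 20 * s := by
      rw [h2, add_mul]
      nlinarith
    have h7 : k * Real.log 2 + 20 * s ≤ (1 - δ) * (k * Real.log 2 + 50 * s) := by
      have h8 : δ * s = 1 / 2 := by
        rw [hδ]
        field_simp
      rw [hks]
      have h9 : δ * (s ^ 2 * Real.log 2 + 50 * s) = δ * s * (s * Real.log 2 + 50) := by ring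
      rw [sub_mul, one_mul, h9, h8]
      nlinarith
    have h10 : (1 - δ) * (f O - f ∅) ≤ (1 - δ) * ((k * Real.log 2 + 50 * s) * (F - f ∅)) := by
      rw [← mul_assoc]
      exact h1.trans (mul_le_mul_of_nonneg_right (h6.trans h7) hG)
    refine le_of_mul_le_mul_left h10 ?_
    have : δ ≤ 1 / 2 := by
      rw [hδ]
      exact one_div_le_one_div_of_le zero_lt_two (by linarith)
    linarith

end Ratio

/-! ### The running time -/

/-- A bound for the running time of `parityProgram`. -/
noncomputable def timePolynomial : MvPolynomial (Fin 2) ℕ :=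
  let N := MvPolynomial.X 0 + 1 + MvPolynomial.X 0 * MvPolynomial.X 1
  100 * (N + 1) + bestSetCost (MvPolynomial.X 0) N N

/-- The cost formula has nonnegative coefficients, hence is monotone, and both `N` and `M` are at
most `n + 1 + n / ε`. -/
theorem cost_le_timePolynomial {n N M : ℕ} {ε : ℝ} (hε : 0 < ε) (hP : Parameters n ε N M) :
    ((100 * (N + 1) + bestSetCost n N M : ℕ) : ℝ) ≤
      MvPolynomial.aeval ![(n : ℝ), ε⁻¹] timePolynomial := by
  have h1 := hP.N_le hε
  have h2 : (M : ℝ) ≤ n + 1 + n * ε⁻¹ := le_trans (by exact_mod_cast hP.M_le) h1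
  have h3 : MvPolynomial.aeval ![(n : ℝ), ε⁻¹] timePolynomial =
      100 * ((n + 1 + n * ε⁻¹) + 1) +
        bestSetCost (n : ℝ) (n + 1 + n * ε⁻¹) (n + 1 + n * ε⁻¹) := by
    simp [timePolynomial, bestSetCost]
  have h4 : ((100 * (N + 1) + bestSetCost n N M : ℕ) : ℝ) =
      100 * ((N : ℝ) + 1) + bestSetCost (n : ℝ) N M := by
    simp [bestSetCost]
  rw [h3, h4]
  simp only [bestSetCost]
  gcongr

/-- The program draws nothing, so its output is constant and the expectation is the value itself. -/
theorem approximates_of_le {n : ℕ} {I : Finset (Fin n) → Prop} {f : Finset (Fin n) → ℝ}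
    {ε ratio : ℝ} {N M : ℕ} (hε : 0 < ε) (hP : Parameters n ε N M) (hI : I (output I f N M))
    (hle : ∀ O, I O → f O ≤ ratio * f (output I f N M)) :
    parityProgram.Approximates timePolynomial I f ε ratio := by
  have : MeasureTheory.IsProbabilityMeasure coinLaw := by
    unfold coinLaw
    infer_instance
  refine ⟨fun _ => output I f N M, fun ω => ?_, fun _ => hI, MeasureTheory.integrable_const _,
    fun O hO => ?_⟩
  · obtain ⟨s', t, he, ht, hs'⟩ := maps_parity (I := I) (f := f) (ω := ω) hP _ rfl
    refine ⟨t, ⟨s', he, hs'⟩, le_trans ?_ (cost_le_timePolynomial hε hP)⟩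
    exact_mod_cast ht
  · simpa using hle O hO

end RealRAM

/-! ### The main theorem -/

theorem theorem1 :
    ∃ (p : RealRAM.Program) (P : MvPolynomial (Fin 2) ℕ) (C : ℝ),
      (∀ ε : ℝ, 0 < ε → ∀ k : ℕ, 1 ≤ k → ∀ (n : ℕ) (V : Type*) (I : MatroidParity k (Fin n) V)
        (f : Finset (Fin n) → ℝ),
        ((∀ S, 0 ≤ f S) → Monotone f → IsSubmodular f →
          p.Approximates P I.Feasible f ε
            (2 * k * Real.log 2 / (1 + Real.log 2) + C * Real.sqrt k)) ∧
        (IsLinearSetFunction f →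
          p.Approximates P I.Feasible f ε ((k + 1) * Real.log 2 + C * ε))) ∧
      ∀ k : ℕ, 2 * k * Real.log 2 / (1 + Real.log 2) ≤ 0.819 * k ∧
        (k + 1) * Real.log 2 ≤ 0.694 * k + 0.694 := by
  have hlog : 0 < Real.log 2 := Real.log_pos one_lt_two
  have hlog9 := Real.log_two_lt_d9
  refine ⟨RealRAM.parityProgram, RealRAM.timePolynomial, 50, ?_, fun k => ⟨?_, ?_⟩⟩
  · intro ε hε k hk n V I f
    obtain ⟨N, M, hP⟩ := RealRAM.exists_parameters n hε
    refine ⟨fun hpos hmono hf => ?_, fun hf => ?_⟩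
    · refine RealRAM.approximates_of_le hε hP
        (RealRAM.bestSet_feasible hf I.feasible_empty) fun O hO =>
        (RealRAM.submodular_le_output hP hk hpos hmono hf hO).trans
          (mul_le_mul_of_nonneg_right ?_ (hpos _))
      gcongr
      -- What remains is `k ln 2 ≤ 2 k ln 2 / (1 + ln 2)`, that is, `1 + ln 2 ≤ 2`.
      rw [le_div_iff₀ (by positivity)]
      have : 0 ≤ (k : ℝ) * Real.log 2 := by positivity
      nlinarith
    · refine RealRAM.approximates_of_le hε hP (RealRAM.bestSet_feasible ?_ I.feasible_empty)
        fun O hO => RealRAM.linear_le_output hP hk hf hO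
      obtain ⟨c, hc⟩ := hf
      intro S T hST e he
      rw [hc, hc, hc, hc, Finset.sum_insert he, Finset.sum_insert fun h => he (hST h)]
      simp
  · rw [div_le_iff₀ (by positivity)]
    have : (0 : ℝ) ≤ k := Nat.cast_nonneg k
    nlinarith
  · have : (0 : ℝ) ≤ k := Nat.cast_nonneg k
    nlinarith
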